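/- Let $\mathbf{k}$ be a field, let $S=\mathbf{k}[x_0,\dots,x_n]$ with its standard grading ($\deg x_i = 1$), let $I\subseteq S$ be a homogeneous ideal, and let $R=S/I$. Let $d$ be the Krull dimension of $R$. For a graded $R$-module $M$ and $i \in \mathbb{Z}$, let $M(i)$ denote the twist with components $M(i)_l = M_{i+l}$. For a (cohomologically indexed, possibly unbounded) complex $C$ of graded $R$-modules and a graded $R$-module $D$, let $$\underline{\mathrm{Ext}}^j_R(C,D)=\bigoplus_{i\in\mathbb{Z}}\mathrm{Hom}\bigl(C,\,D(i)[j]\bigr),$$ where $\mathrm{Hom}$ is taken in the derived category of graded $R$-modules (with degree-preserving maps); this is a graded $R$-module. Assume that $R$ is (graded) Gorenstein, i.e. $\underline{\mathrm{Ext}}^d_R(\mathbf{k},R)\cong\mathbf{k}(a)$ as graded $R$-modules for some $a\in\mathbb{Z}$, and $\underline{\mathrm{Ext}}^i_R(\mathbf{k},R)=0$ for all $i\neq d$; here $\mathbf{k}=R/(x_0,\dots,x_n)$ (so $R\neq 0$). Let $C$ be a complex of finitely generated graded $R$-modules, and let $s,u\in\mathbb{Z}$. If $H^j(C)=0$ unless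 $s\le j\le u$, then $\underline{\mathrm{Ext}}^j_R(C,R)=0$ unless $-u\le j\le d-s$. -/

import Mathlib

open CategoryTheory CategoryTheory.Limits

universe u v w

/-! ### Decompositions from projections -/

/-- A family of additive subgroups spanning `M`, with a compatible family of additive projections,
is a direct sum decomposition. -/
@[reducible]
noncomputable def decompositionOfProj {M σ : Type*} [AddCommGroup M] [SetLike σ M]
    [AddSubgroupClass σ M] (deg : ℤ → σ) (p : ℤ → M →+ M)
    (same : ∀ i, ∀ x ∈ deg i, p i x = x)
    (ne : ∀ i j, j ≠ i → ∀ x ∈ deg i, p j x = 0)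
    (span : ∀ x, x ∈ AddSubmonoid.closure (⋃ i, (deg i : Set M))) :
    DirectSum.Decomposition deg :=
  DirectSum.IsInternal.chooseDecomposition deg <| by
    have key : ∀ (y : DirectSum ℤ fun i => deg i) (j : ℤ),
        p j (DirectSum.coeAddMonoidHom deg y) = y j := by
      intro y j
      induction y using DirectSum.induction_on with
      | zero => simp
      | of i x =>
        rw [DirectSum.coeAddMonoidHom_of]
        by_cases h : j = i
        · subst h
          rw [same _ _ x.2, DirectSum.of_eq_same]
        · rw [ne i j h _ x.2, DirectSum.of_eq_of_ne _ _ _ h]; rfl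
      | add x y hx hy => rw [map_add, map_add, hx, hy, DirectSum.add_apply]; rfl
    constructor
    · intro x y hxy
      ext j
      rw [← key, ← key, hxy]
    · intro x
      induction span x using AddSubmonoid.closure_induction with
      | mem x hx =>
        obtain ⟨i, hi⟩ := Set.mem_iUnion.1 hx
        exact ⟨DirectSum.of (fun i => deg i) i ⟨x, hi⟩, DirectSum.coeAddMonoidHom_of deg i _⟩
      | zero => exact ⟨0, map_zero _⟩
      | add x y _ _ hx hy =>
        obtain ⟨a, rfl⟩ := hx
        obtain ⟨b, rfl⟩ := hy
        exact ⟨a + b, map_add _ _ _⟩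

/-- The projection onto the `i`-th component of a decomposition. -/
def decompProj {M σ : Type*} [AddCommGroup M] [SetLike σ M] [AddSubgroupClass σ M]
    (deg : ℤ → σ) [DirectSum.Decomposition deg] (i : ℤ) : M →+ M where
  toFun x := (DirectSum.decompose deg x i : M)
  map_zero' := by simp
  map_add' x y := by simp

theorem decompProj_mem {M σ : Type*} [AddCommGroup M] [SetLike σ M] [AddSubgroupClass σ M]
    (deg : ℤ → σ) [DirectSum.Decomposition deg] (i : ℤ) (x : M) : decompProj deg i x ∈ deg i :=
  (DirectSum.decompose deg x i).2

theorem decompProj_same {M σ : Type*} [AddCommGroup M] [SetLike σ M] [AddSubgroupClass σ M]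
    (deg : ℤ → σ) [DirectSum.Decomposition deg] (i : ℤ) (x : M) (hx : x ∈ deg i) :
    decompProj deg i x = x :=
  DirectSum.decompose_of_mem_same deg hx

theorem decompProj_ne {M σ : Type*} [AddCommGroup M] [SetLike σ M] [AddSubgroupClass σ M]
    (deg : ℤ → σ) [DirectSum.Decomposition deg] (i j : ℤ) (h : j ≠ i) (x : M) (hx : x ∈ deg i) :
    decompProj deg j x = 0 :=
  DirectSum.decompose_of_mem_ne deg hx h.symm

theorem decompProj_span {M σ : Type*} [AddCommGroup M] [SetLike σ M] [AddSubgroupClass σ M]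
    (deg : ℤ → σ) [DirectSum.Decomposition deg] (x : M) :
    x ∈ AddSubmonoid.closure (⋃ i, (deg i : Set M)) := by
  induction x using DirectSum.Decomposition.inductionOn deg with
  | zero => exact zero_mem _
  | homogeneous m => exact AddSubmonoid.subset_closure (Set.mem_iUnion.2 ⟨_, m.2⟩)
  | add x y hx hy => exact add_mem hx hy

theorem sum_decompProj {M σ : Type*} [AddCommGroup M] [SetLike σ M] [AddSubgroupClass σ M]
    (deg : ℤ → σ) [DirectSum.Decomposition deg] (x : M) :
    ∃ s : Finset ℤ, x = ∑ i ∈ s, decompProj deg i x := by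
  classical
  exact ⟨_, (DirectSum.sum_support_decompose deg x).symm⟩

/-! ### Graded modules -/

/-- A `ℤ`-graded module over the `ℤ`-graded ring `A = ⨁ 𝒜 i`. -/
structure GrMod {k A : Type u} [CommRing k] [CommRing A] [Algebra k A]
    (𝒜 : ℤ → Submodule k A) where
  carrier : Type v
  [addCommGroup : AddCommGroup carrier]
  [module : Module A carrier]
  /-- The homogeneous components. -/
  deg : ℤ → AddSubgroup carrier
  [decomposition : DirectSum.Decomposition deg]
  [gradedSMul : SetLike.GradedSMul 𝒜 deg]

namespace GrMod

attribute [instance] GrMod.addCommGroup GrMod.module GrMod.decomposition GrMod.gradedSMul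

section

variable {k A : Type u} [CommRing k] [CommRing A] [Algebra k A] {𝒜 : ℤ → Submodule k A}

theorem smul_mem_deg (M : GrMod.{u, v} 𝒜) {e i l : ℤ} (h : e + i = l) {a : A} {x : M.carrier}
    (ha : a ∈ 𝒜 e) (hx : x ∈ M.deg i) : a • x ∈ M.deg l :=
  h ▸ SetLike.GradedSMul.smul_mem ha hx

/-- The `A`-linear maps preserving internal degrees. -/
def homSubgroup (M N : GrMod.{u, v} 𝒜) : AddSubgroup (M.carrier →ₗ[A] N.carrier) where
  carrier := {f | ∀ i, ∀ x ∈ M.deg i, f x ∈ N.deg i}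
  zero_mem' _ _ _ := zero_mem _
  add_mem' hf hg i x hx := add_mem (hf i x hx) (hg i x hx)
  neg_mem' hf i x hx := neg_mem (hf i x hx)

instance : Category.{v} (GrMod.{u, v} 𝒜) where
  Hom M N := homSubgroup M N
  id M := ⟨LinearMap.id, fun _ _ hx => hx⟩
  comp f g := ⟨g.1.comp f.1, fun i x hx => g.2 i _ (f.2 i x hx)⟩

/-- The underlying linear map of a morphism of graded modules. -/
def lin {M N : GrMod.{u, v} 𝒜} (f : M ⟶ N) : M.carrier →ₗ[A] N.carrier := f.1

theorem lin_mem {M N : GrMod.{u, v} 𝒜} (f : M ⟶ N) {i : ℤ} {x : M.carrier} (hx : x ∈ M.deg i) :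
    lin f x ∈ N.deg i := f.2 i x hx

/-- Build a morphism of graded modules. -/
def mkHom {M N : GrMod.{u, v} 𝒜} (f : M.carrier →ₗ[A] N.carrier)
    (hf : ∀ i, ∀ x ∈ M.deg i, f x ∈ N.deg i) : M ⟶ N := ⟨f, hf⟩

@[simp] theorem lin_mkHom {M N : GrMod.{u, v} 𝒜} (f : M.carrier →ₗ[A] N.carrier)
    (hf : ∀ i, ∀ x ∈ M.deg i, f x ∈ N.deg i) : lin (mkHom f hf) = f := rfl

@[ext] theorem hom_ext {M N : GrMod.{u, v} 𝒜} {f g : M ⟶ N} (h : ∀ x, lin f x = lin g x) :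
    f = g := Subtype.ext (LinearMap.ext h)

@[simp] theorem lin_id (M : GrMod.{u, v} 𝒜) : lin (𝟙 M) = LinearMap.id := rfl

@[simp] theorem lin_comp {M N P : GrMod.{u, v} 𝒜} (f : M ⟶ N) (g : N ⟶ P) :
    lin (f ≫ g) = (lin g).comp (lin f) := rfl

instance : Preadditive (GrMod.{u, v} 𝒜) where
  homGroup M N := inferInstanceAs (AddCommGroup (homSubgroup M N))
  add_comp _ _ _ f f' g := Subtype.ext (LinearMap.comp_add f.1 f'.1 g.1)
  comp_add _ _ _ f g g' := Subtype.ext (LinearMap.add_comp f.1 g'.1 g.1)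

@[simp] theorem lin_zero (M N : GrMod.{u, v} 𝒜) : lin (0 : M ⟶ N) = 0 := rfl

@[simp] theorem lin_add {M N : GrMod.{u, v} 𝒜} (f g : M ⟶ N) : lin (f + g) = lin f + lin g := rfl

theorem lin_proj {M N : GrMod.{u, v} 𝒜} (f : M ⟶ N) (i : ℤ) (x : M.carrier) :
    lin f (decompProj M.deg i x) = decompProj N.deg i (lin f x) := by
  induction x using DirectSum.Decomposition.inductionOn M.deg with
  | zero => simp
  | @homogeneous j m =>
    by_cases h : i = j
    · subst h
      rw [decompProj_same _ _ _ m.2, decompProj_same _ _ _ (lin_mem f m.2)]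
    · rw [decompProj_ne _ _ _ h _ m.2, decompProj_ne _ _ _ h _ (lin_mem f m.2), map_zero]
  | add x y hx hy => simp only [map_add, hx, hy]

/-- An element whose image under an injective morphism is homogeneous is homogeneous. -/
theorem mem_deg_of_injective {M N : GrMod.{u, v} 𝒜} (f : M ⟶ N)
    (hf : Function.Injective (lin f)) {i : ℤ} {x : M.carrier} (hx : lin f x ∈ N.deg i) :
    x ∈ M.deg i := by
  have : decompProj M.deg i x = x := hf (by rw [lin_proj, decompProj_same _ _ _ hx])
  exact this ▸ decompProj_mem M.deg i x

/-- A homogeneous submodule, as a graded module. -/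
noncomputable def sub (M : GrMod.{u, v} 𝒜) (N : Submodule A M.carrier)
    (hN : N.IsHomogeneous M.deg) : GrMod.{u, v} 𝒜 :=
  let deg' : ℤ → AddSubgroup N := fun i => (M.deg i).comap N.subtype.toAddMonoidHom
  let p : ℤ → N →+ N := fun i =>
    { toFun := fun x => ⟨decompProj M.deg i x, hN i x.2⟩
      map_zero' := Subtype.ext (map_zero _)
      map_add' := fun _ _ => Subtype.ext (map_add _ _ _) }
  { carrier := N
    deg := deg'
    decomposition := decompositionOfProj deg' p
      (fun i x hx => Subtype.ext (decompProj_same M.deg i _ hx))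
      (fun i j h x hx => Subtype.ext (decompProj_ne M.deg i j h _ hx))
      (fun x => by
        obtain ⟨s, hs⟩ := sum_decompProj M.deg x.1
        have : x = ∑ i ∈ s, p i x := by
          apply Subtype.ext
          rw [AddSubmonoidClass.coe_finsetSum]
          exact hs
        rw [this]
        exact sum_mem fun i _ => AddSubmonoid.subset_closure
          (Set.mem_iUnion.2 ⟨i, decompProj_mem M.deg i x.1⟩))
    gradedSMul := ⟨fun {_ _ _ x} ha hx => M.smul_mem_deg rfl ha (x := x.1) hx⟩ }

/-- The quotient by a homogeneous submodule, as a graded module. -/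
noncomputable def quot (M : GrMod.{u, v} 𝒜) (N : Submodule A M.carrier)
    (hN : N.IsHomogeneous M.deg) : GrMod.{u, v} 𝒜 :=
  let deg' : ℤ → AddSubgroup (M.carrier ⧸ N) := fun i => (M.deg i).map N.mkQ.toAddMonoidHom
  let p : ℤ → (M.carrier ⧸ N) →+ (M.carrier ⧸ N) := fun i =>
    QuotientAddGroup.lift N.toAddSubgroup (N.mkQ.toAddMonoidHom.comp (decompProj M.deg i))
      (fun _ hx => (Submodule.Quotient.mk_eq_zero N).2 (hN i hx))
  { carrier := M.carrier ⧸ N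
    deg := deg'
    decomposition := decompositionOfProj deg' p
      (fun i x hx => by
        obtain ⟨y, hy, rfl⟩ := hx
        exact congrArg N.mkQ (decompProj_same M.deg i y hy))
      (fun i j h x hx => by
        obtain ⟨y, hy, rfl⟩ := hx
        exact (congrArg N.mkQ (decompProj_ne M.deg i j h y hy)).trans (map_zero _))
      (fun x => by
        obtain ⟨y, rfl⟩ := N.mkQ_surjective x
        obtain ⟨s, hs⟩ := sum_decompProj M.deg y
        rw [hs, map_sum]
        exact sum_mem fun i _ => AddSubmonoid.subset_closure
          (Set.mem_iUnion.2 ⟨i, _, decompProj_mem M.deg i y, rfl⟩))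
    gradedSMul := ⟨fun {_ _ a _} ha hx => by
      obtain ⟨y, hy, rfl⟩ := hx
      exact ⟨a • y, M.smul_mem_deg rfl ha hy, map_smul N.mkQ a y⟩⟩ }

/-- The twist `M(j)`, with components `M(j)_i = M_{i+j}`. -/
noncomputable def twist (M : GrMod.{u, v} 𝒜) (j : ℤ) : GrMod.{u, v} 𝒜 :=
  let deg' : ℤ → AddSubgroup M.carrier := fun i => M.deg (i + j)
  { carrier := M.carrier
    deg := deg'
    decomposition := decompositionOfProj deg' (fun i => decompProj M.deg (i + j))
      (fun i x hx => decompProj_same M.deg (i + j) x hx)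
      (fun i l h x hx => decompProj_ne M.deg (i + j) (l + j) (by simpa using h) x hx)
      (fun x => by
        have : (⋃ i, (deg' i : Set M.carrier)) = ⋃ i, (M.deg i : Set M.carrier) :=
          (Equiv.addRight j).surjective.iUnion_comp fun i => (M.deg i : Set M.carrier)
        rw [this]
        exact decompProj_span M.deg x)
    gradedSMul := ⟨fun {e i _ _} ha hx => M.smul_mem_deg (e := e) (i := i + j)
      (by simp only [vadd_eq_add]; ring) ha hx⟩ }

/-- The direct sum of two graded modules. -/
noncomputable def prod (M N : GrMod.{u, v} 𝒜) : GrMod.{u, v} 𝒜 :=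
  let deg' : ℤ → AddSubgroup (M.carrier × N.carrier) := fun i => (M.deg i).prod (N.deg i)
  let p : ℤ → (M.carrier × N.carrier) →+ (M.carrier × N.carrier) := fun i =>
    (decompProj M.deg i).prodMap (decompProj N.deg i)
  { carrier := M.carrier × N.carrier
    deg := deg'
    decomposition := decompositionOfProj deg' p
      (fun i x hx => Prod.ext (decompProj_same M.deg i _ hx.1) (decompProj_same N.deg i _ hx.2))
      (fun i j h x hx =>
        Prod.ext (decompProj_ne M.deg i j h _ hx.1) (decompProj_ne N.deg i j h _ hx.2))
      (fun x => by
        obtain ⟨s, hs⟩ := sum_decompProj M.deg x.1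
        obtain ⟨t, ht⟩ := sum_decompProj N.deg x.2
        have : x = ∑ i ∈ s, (AddMonoidHom.inl M.carrier N.carrier) (decompProj M.deg i x.1)
            + ∑ i ∈ t, (AddMonoidHom.inr M.carrier N.carrier) (decompProj N.deg i x.2) := by
          rw [← map_sum, ← map_sum, ← hs, ← ht]
          simp
        rw [this]
        refine add_mem (sum_mem fun i _ => ?_) (sum_mem fun i _ => ?_)
        · exact AddSubmonoid.subset_closure
            (Set.mem_iUnion.2 ⟨i, decompProj_mem M.deg i x.1, zero_mem _⟩)
        · exact AddSubmonoid.subset_closure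
            (Set.mem_iUnion.2 ⟨i, zero_mem _, decompProj_mem N.deg i x.2⟩))
    gradedSMul := ⟨fun {_ _ _ _} ha hx =>
      ⟨M.smul_mem_deg rfl ha hx.1, N.smul_mem_deg rfl ha hx.2⟩⟩ }

/-- The zero graded module. -/
noncomputable def zeroObj : GrMod.{u, v} 𝒜 :=
  let deg' : ℤ → AddSubgroup PUnit.{v + 1} := fun _ => ⊤
  { carrier := PUnit.{v + 1}
    deg := deg'
    decomposition := decompositionOfProj deg' (fun _ => 0)
      (fun _ _ _ => rfl) (fun _ _ _ _ _ => rfl) (fun _ => zero_mem _)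
    gradedSMul := ⟨fun {_ _ _ _} _ _ => trivial⟩ }

/-! ### Graded modules form an abelian category -/

theorem ker_isHomogeneous {M N : GrMod.{u, v} 𝒜} (f : M ⟶ N) :
    (LinearMap.ker (lin f)).IsHomogeneous M.deg := by
  intro i x hx
  have h : lin f x = 0 := hx
  exact (lin_proj f i x).trans (by rw [h, map_zero])

theorem range_isHomogeneous {M N : GrMod.{u, v} 𝒜} (f : M ⟶ N) :
    (LinearMap.range (lin f)).IsHomogeneous N.deg := by
  rintro i _ ⟨x, rfl⟩
  exact ⟨decompProj M.deg i x, lin_proj f i x⟩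

/-- The kernel of a morphism. -/
noncomputable def ker {M N : GrMod.{u, v} 𝒜} (f : M ⟶ N) : GrMod.{u, v} 𝒜 :=
  M.sub (LinearMap.ker (lin f)) (ker_isHomogeneous f)

/-- The inclusion of the kernel. -/
noncomputable def kerι {M N : GrMod.{u, v} 𝒜} (f : M ⟶ N) : ker f ⟶ M :=
  mkHom (M := ker f) (LinearMap.ker (lin f)).subtype (fun _ _ hx => hx)

theorem kerι_comp {M N : GrMod.{u, v} 𝒜} (f : M ⟶ N) : kerι f ≫ f = 0 :=
  hom_ext fun x => x.2

/-- The cokernel of a morphism. -/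
noncomputable def coker {M N : GrMod.{u, v} 𝒜} (f : M ⟶ N) : GrMod.{u, v} 𝒜 :=
  N.quot (LinearMap.range (lin f)) (range_isHomogeneous f)

/-- The projection onto the cokernel. -/
noncomputable def cokerπ {M N : GrMod.{u, v} 𝒜} (f : M ⟶ N) : N ⟶ coker f :=
  mkHom (N := coker f) (LinearMap.range (lin f)).mkQ (fun _ x hx => ⟨x, hx, rfl⟩)

theorem comp_cokerπ {M N : GrMod.{u, v} 𝒜} (f : M ⟶ N) : f ≫ cokerπ f = 0 :=
  hom_ext fun x => (Submodule.Quotient.mk_eq_zero _).2 ⟨x, rfl⟩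

theorem exists_lift {K M N Z : GrMod.{u, v} 𝒜} (ι : K ⟶ M) (f : M ⟶ N)
    (inj : Function.Injective (lin ι)) (ex : ∀ x, lin f x = 0 → ∃ y, lin ι y = x)
    (g : Z ⟶ M) (hg : g ≫ f = 0) : ∃ l : Z ⟶ K, l ≫ ι = g := by
  have h0 : ∀ z, ∃ y, lin ι y = lin g z := fun z =>
    ex _ (congrArg (fun h : Z ⟶ N => lin h z) hg)
  choose l hl using h0
  exact ⟨mkHom
    { toFun := l
      map_add' := fun x y => inj (by simp only [map_add, hl])
      map_smul' := fun a x => inj (by simp only [map_smul, hl, RingHom.id_apply]) }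
    (fun i z hz => mem_deg_of_injective ι inj (by
      change lin ι (l z) ∈ _
      rw [hl]
      exact lin_mem g hz)), hom_ext hl⟩

theorem exists_desc {M N Q Z : GrMod.{u, v} 𝒜} (f : M ⟶ N) (π : N ⟶ Q)
    (surj : Function.Surjective (lin π)) (ex : ∀ x, lin π x = 0 → ∃ y, lin f y = x)
    (g : N ⟶ Z) (hg : f ≫ g = 0) : ∃ l : Q ⟶ Z, π ≫ l = g := by
  have h0 : ∀ x y, lin π x = lin π y → lin g x = lin g y := fun x y hxy => by
    obtain ⟨m, hm⟩ := ex (x - y) (by rw [map_sub, hxy, sub_self])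
    have : lin g (lin f m) = 0 := congrArg (fun h : M ⟶ Z => lin h m) hg
    rw [hm, map_sub] at this
    exact sub_eq_zero.1 this
  choose r hr using surj
  have h1 : ∀ x, lin g (r (lin π x)) = lin g x := fun x => h0 _ _ (hr _)
  exact ⟨mkHom
    { toFun := fun q => lin g (r q)
      map_add' := fun x y => by
        rw [← map_add]
        exact h0 _ _ (by simp only [map_add, hr])
      map_smul' := fun a x => by
        rw [RingHom.id_apply, ← map_smul]
        exact h0 _ _ (by simp only [map_smul, hr]) }
    (fun i q hq => by
      have h2 : lin π (decompProj N.deg i (r q)) = lin π (r q) := by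
        rw [lin_proj, decompProj_same _ _ _ (by rw [hr]; exact hq)]
      change lin g (r q) ∈ _
      rw [← h0 _ _ h2]
      exact lin_mem g (decompProj_mem N.deg i _)), hom_ext h1⟩

/-- An injective morphism is a kernel of any morphism with which it forms an exact pair. -/
noncomputable def isKernelOfExact {K M N : GrMod.{u, v} 𝒜} (ι : K ⟶ M) (f : M ⟶ N)
    (w : ι ≫ f = 0) (inj : Function.Injective (lin ι))
    (ex : ∀ x, lin f x = 0 → ∃ y, lin ι y = x) : IsLimit (KernelFork.ofι ι w) :=
  KernelFork.IsLimit.ofι ι w (fun g hg => (exists_lift ι f inj ex g hg).choose)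
    (fun g hg => (exists_lift ι f inj ex g hg).choose_spec)
    (fun g hg _ hm => hom_ext fun x => inj
      (congrArg (fun h : _ ⟶ M => lin h x)
        (hm.trans (exists_lift ι f inj ex g hg).choose_spec.symm)))

/-- A surjective morphism is a cokernel of any morphism with which it forms an exact pair. -/
noncomputable def isCokernelOfExact {M N Q : GrMod.{u, v} 𝒜} (f : M ⟶ N) (π : N ⟶ Q)
    (w : f ≫ π = 0) (surj : Function.Surjective (lin π))
    (ex : ∀ x, lin π x = 0 → ∃ y, lin f y = x) : IsColimit (CokernelCofork.ofπ π w) :=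
  CokernelCofork.IsColimit.ofπ π w (fun g hg => (exists_desc f π surj ex g hg).choose)
    (fun g hg => (exists_desc f π surj ex g hg).choose_spec)
    (fun g hg _ hm => hom_ext fun x => by
      obtain ⟨y, rfl⟩ := surj x
      exact congrArg (fun h : N ⟶ _ => lin h y)
        (hm.trans (exists_desc f π surj ex g hg).choose_spec.symm))

instance : HasKernels (GrMod.{u, v} 𝒜) where
  has_limit f := ⟨⟨⟨_, isKernelOfExact (kerι f) f (kerι_comp f) Subtype.val_injective
    (fun x hx => ⟨⟨x, hx⟩, rfl⟩)⟩⟩⟩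

instance : HasCokernels (GrMod.{u, v} 𝒜) where
  has_colimit f := ⟨⟨⟨_, isCokernelOfExact f (cokerπ f) (comp_cokerπ f)
    (Submodule.mkQ_surjective _) (fun _ hx => (Submodule.Quotient.mk_eq_zero _).1 hx)⟩⟩⟩

theorem injective_of_mono {M N : GrMod.{u, v} 𝒜} (f : M ⟶ N) [Mono f] :
    Function.Injective (lin f) := by
  have h : kerι f = 0 := by
    rw [← cancel_mono f, kerι_comp, zero_comp]
  rw [← LinearMap.ker_eq_bot, eq_bot_iff]
  intro x hx
  exact congrArg (fun g : ker f ⟶ M => lin g ⟨x, hx⟩) h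

theorem surjective_of_epi {M N : GrMod.{u, v} 𝒜} (f : M ⟶ N) [Epi f] :
    Function.Surjective (lin f) := by
  have h : cokerπ f = 0 := by
    rw [← cancel_epi f, comp_cokerπ, comp_zero]
  intro x
  have : (LinearMap.range (lin f)).mkQ x = 0 := congrArg (fun g : N ⟶ coker f => lin g x) h
  exact (Submodule.Quotient.mk_eq_zero _).1 this

instance : HasTerminal (GrMod.{u, v} 𝒜) :=
  IsTerminal.hasTerminal (X := zeroObj) <|
    IsTerminal.ofUniqueHom (fun _ => 0) (fun _ _ => hom_ext fun _ => rfl)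

instance : HasBinaryProducts (GrMod.{u, v} 𝒜) :=
  have (M N : GrMod.{u, v} 𝒜) : HasLimit (pair M N) :=
    ⟨⟨⟨_, BinaryFan.isLimitMk (W := M.prod N)
      (fst := mkHom (M := M.prod N) (LinearMap.fst A M.carrier N.carrier) (fun _ _ hx => hx.1))
      (snd := mkHom (M := M.prod N) (LinearMap.snd A M.carrier N.carrier) (fun _ _ hx => hx.2))
      (fun s => mkHom (N := M.prod N) ((lin s.fst).prod (lin s.snd))
        (fun _ _ hx => ⟨lin_mem s.fst hx, lin_mem s.snd hx⟩))
      (fun _ => hom_ext fun _ => rfl) (fun _ => hom_ext fun _ => rfl)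
      (fun s _ h1 h2 => hom_ext fun x => Prod.ext
        (congrArg (fun g : s.pt ⟶ M => lin g x) h1)
        (congrArg (fun g : s.pt ⟶ N => lin g x) h2))⟩⟩⟩
  hasBinaryProducts_of_hasLimit_pair _

noncomputable instance : Abelian (GrMod.{u, v} 𝒜) where
  normalMonoOfMono f _ := ⟨
    { Z := coker f
      g := cokerπ f
      w := comp_cokerπ f
      isLimit := isKernelOfExact f (cokerπ f) (comp_cokerπ f) (injective_of_mono f)
        (fun _ hx => (Submodule.Quotient.mk_eq_zero _).1 hx) }⟩
  normalEpiOfEpi f _ := ⟨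
    { W := ker f
      g := kerι f
      w := kerι_comp f
      isColimit := isCokernelOfExact (kerι f) f (kerι_comp f) (surjective_of_epi f)
        (fun x hx => ⟨⟨x, hx⟩, rfl⟩) }⟩
  has_finite_products := hasFiniteProducts_of_has_binary_and_terminal

/-- The derived category of graded modules: the localization of the category of cochain complexes
at the quasi-isomorphisms. -/
noncomputable instance : HasDerivedCategory.{u + 1} (GrMod.{u, u} 𝒜) :=
  HasDerivedCategory.standard _

/-- An isomorphism of graded modules (possibly in different universes). -/
def GrIso (M : GrMod.{u, v} 𝒜) (N : GrMod.{u, w} 𝒜) : Prop :=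
  ∃ f : M.carrier ≃ₗ[A] N.carrier, ∀ i x, x ∈ M.deg i ↔ f x ∈ N.deg i

end

section

variable {k A : Type u} [CommRing k] [CommRing A] [Algebra k A]

/-- The graded ring, as a graded module over itself. -/
noncomputable def self (𝒜 : ℤ → Submodule k A) [GradedAlgebra 𝒜] : GrMod.{u, u} 𝒜 :=
  let deg' : ℤ → AddSubgroup A := fun i => (𝒜 i).toAddSubgroup
  { carrier := A
    deg := deg'
    decomposition := decompositionOfProj deg' (fun i => decompProj 𝒜 i)
      (fun i x hx => decompProj_same 𝒜 i x hx)
      (fun i j h x hx => decompProj_ne 𝒜 i j h x hx)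
      (fun x => decompProj_span 𝒜 x)
    gradedSMul := ⟨fun {_ _ _ _} ha hx => SetLike.GradedMul.mul_mem (A := 𝒜) ha hx⟩ }

/-- The ideal generated by the homogeneous elements of positive degree. -/
def irrelevant (𝒜 : ℤ → Submodule k A) : Ideal A :=
  Ideal.span {a | ∃ e : ℤ, 0 < e ∧ a ∈ 𝒜 e}

/-- The same ideal, as a submodule of the graded module `A`. -/
def irrelevantSub (𝒜 : ℤ → Submodule k A) [GradedAlgebra 𝒜] : Submodule A (self 𝒜).carrier :=
  irrelevant 𝒜

theorem irrelevant_isHomogeneous (𝒜 : ℤ → Submodule k A) [GradedAlgebra 𝒜] :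
    (irrelevantSub 𝒜).IsHomogeneous (self 𝒜).deg := by
  have h : (irrelevant 𝒜).IsHomogeneous 𝒜 := Ideal.homogeneous_span 𝒜 _ (by
    rintro x ⟨e, _, hx⟩
    exact ⟨e, hx⟩)
  intro i x hx
  have h1 := h i hx
  have h2 : ∀ y : A, decompProj (self 𝒜).deg i y = decompProj 𝒜 i y := by
    intro y
    induction y using DirectSum.Decomposition.inductionOn 𝒜 with
    | zero => exact (map_zero _).trans (map_zero _).symm
    | @homogeneous j m =>
      have hm : (m : A) ∈ (self 𝒜).deg j := m.2
      by_cases hij : i = j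
      · subst hij
        rw [decompProj_same 𝒜 _ _ m.2]
        exact decompProj_same (self 𝒜).deg _ _ hm
      · rw [decompProj_ne 𝒜 _ _ hij _ m.2]
        exact decompProj_ne (self 𝒜).deg _ _ hij _ hm
    | add x y hx hy =>
      rw [map_add, ← hx, ← hy]
      exact map_add (decompProj (self 𝒜).deg i) x y
  exact (congrArg (· ∈ irrelevant 𝒜) (h2 x)).mpr h1

/-- The graded module `A / A_{>0}A`; it is the residue field when `A` is a quotient of a
polynomial ring over a field by a proper homogeneous ideal. -/
noncomputable def residue (𝒜 : ℤ → Submodule k A) [GradedAlgebra 𝒜] : GrMod.{u, u} 𝒜 :=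
  (self 𝒜).quot (irrelevantSub 𝒜) (irrelevant_isHomogeneous 𝒜)

end

/-! ### Graded Ext -/

section

variable {k A : Type u} [CommRing k] [CommRing A] [Algebra k A] {𝒜 : ℤ → Submodule k A}

/-- Multiplication by a homogeneous element of degree `e`, as a map `D(i) ⟶ D(e+i)`. -/
noncomputable def mulBy (D : GrMod.{u, v} 𝒜) (e i : ℤ) :
    𝒜 e →+ (D.twist i ⟶ D.twist (e + i)) where
  toFun a := mkHom (M := D.twist i) (N := D.twist (e + i)) (LinearMap.lsmul A D.carrier a)
    (fun n x hx => D.smul_mem_deg (e := e) (i := n + i) (by ring) a.2 hx)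
  map_zero' := hom_ext fun x => zero_smul A (x : D.carrier)
  map_add' a b := hom_ext fun x => add_smul (a : A) (b : A) (x : D.carrier)

/-- The internal degree `i` part of `Ext^j(C, D)`: the group of morphisms `C ⟶ D(i)[j]` in the
derived category of graded modules. -/
abbrev ExtDeg (C : CochainComplex (GrMod.{u, u} 𝒜) ℤ) (D : GrMod.{u, u} 𝒜) (j i : ℤ) :
    Type (u + 1) :=
  DerivedCategory.Q.obj C ⟶
    ((DerivedCategory.singleFunctor (GrMod.{u, u} 𝒜) 0).obj (D.twist i))⟦j⟧

/-- Functoriality of `Ext^j(C, -)` in degree zero maps. -/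
noncomputable def extMap (C : CochainComplex (GrMod.{u, u} 𝒜) ℤ) {X Y : GrMod.{u, u} 𝒜} (j : ℤ) :
    (X ⟶ Y) →+
      ((DerivedCategory.Q.obj C ⟶
        ((DerivedCategory.singleFunctor (GrMod.{u, u} 𝒜) 0).obj X)⟦j⟧) →+
      (DerivedCategory.Q.obj C ⟶
        ((DerivedCategory.singleFunctor (GrMod.{u, u} 𝒜) 0).obj Y)⟦j⟧)) where
  toFun f :=
    { toFun := fun x => x ≫ ((DerivedCategory.singleFunctor (GrMod.{u, u} 𝒜) 0).map f)⟦j⟧'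
      map_zero' := zero_comp
      map_add' := fun x y => Preadditive.add_comp _ _ _ _ _ _ }
  map_zero' := by ext x; simp
  map_add' f g := by ext x; simp [Functor.map_add]

/-- The action of a homogeneous element of `A` on `⨁ i, Ext^j(C, D(i))`. -/
noncomputable def extAct (C : CochainComplex (GrMod.{u, u} 𝒜) ℤ) (D : GrMod.{u, u} 𝒜) (j e : ℤ) :
    𝒜 e →+ (DirectSum ℤ (ExtDeg C D j) →+ DirectSum ℤ (ExtDeg C D j)) where
  toFun a := DirectSum.toAddMonoid fun i =>
    (DirectSum.of (ExtDeg C D j) (e + i)).comp (extMap C j (D.mulBy e i a))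
  map_zero' := by
    refine DirectSum.addHom_ext fun i x => ?_
    rw [DirectSum.toAddMonoid_of, map_zero, map_zero]
    exact map_zero (DirectSum.of (ExtDeg C D j) (e + i))
  map_add' a b := by
    refine DirectSum.addHom_ext fun i x => ?_
    rw [AddMonoidHom.add_apply, DirectSum.toAddMonoid_of, DirectSum.toAddMonoid_of,
      DirectSum.toAddMonoid_of, map_add, map_add]
    exact map_add (DirectSum.of (ExtDeg C D j) (e + i)) _ _

theorem extAct_of (C : CochainComplex (GrMod.{u, u} 𝒜) ℤ) (D : GrMod.{u, u} 𝒜) (j e : ℤ)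
    (a : 𝒜 e) (i : ℤ) (x : ExtDeg C D j i) :
    extAct C D j e a (DirectSum.of (ExtDeg C D j) i x) =
      DirectSum.of (ExtDeg C D j) (e + i) (extMap C j (D.mulBy e i a) x) :=
  DirectSum.toAddMonoid_of _ _ _

theorem extMap_of_eq (C : CochainComplex (GrMod.{u, u} 𝒜) ℤ) (D : GrMod.{u, u} 𝒜) (j : ℤ)
    {i l l' : ℤ} (h : l = l') (f : D.twist i ⟶ D.twist l) (g : D.twist i ⟶ D.twist l')
    (hfg : ∀ x : D.carrier, (lin f x : D.carrier) = lin g x) (x : ExtDeg C D j i) :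
    DirectSum.of (ExtDeg C D j) l (extMap C j f x) =
      DirectSum.of (ExtDeg C D j) l' (extMap C j g x) := by
  subst h
  rw [show f = g from hom_ext hfg]

theorem extMap_id (C : CochainComplex (GrMod.{u, u} 𝒜) ℤ) (X : GrMod.{u, u} 𝒜) (j : ℤ)
    (x : DerivedCategory.Q.obj C ⟶
      ((DerivedCategory.singleFunctor (GrMod.{u, u} 𝒜) 0).obj X)⟦j⟧) :
    extMap C j (𝟙 X) x = x := by
  simp [extMap]

theorem extMap_comp (C : CochainComplex (GrMod.{u, u} 𝒜) ℤ) {X Y Z : GrMod.{u, u} 𝒜} (j : ℤ)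
    (f : X ⟶ Y) (g : Y ⟶ Z)
    (x : DerivedCategory.Q.obj C ⟶
      ((DerivedCategory.singleFunctor (GrMod.{u, u} 𝒜) 0).obj X)⟦j⟧) :
    extMap C j (f ≫ g) x = extMap C j g (extMap C j f x) := by
  simp [extMap]

end

section

variable {k A : Type u} [CommRing k] [CommRing A] [Algebra k A]
  {𝒜 : ℤ → Submodule k A} [GradedAlgebra 𝒜]

/-- The additive map underlying the action of `A` on `⨁ i, Ext^j(C, D(i))`. -/
noncomputable def extActAdd (C : CochainComplex (GrMod.{u, u} 𝒜) ℤ) (D : GrMod.{u, u} 𝒜) (j : ℤ) :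
    A →+ (DirectSum ℤ (ExtDeg C D j) →+ DirectSum ℤ (ExtDeg C D j)) :=
  (DirectSum.toAddMonoid fun e => extAct C D j e).comp
    (DirectSum.decomposeAddEquiv 𝒜).toAddMonoidHom

theorem extActAdd_coe (C : CochainComplex (GrMod.{u, u} 𝒜) ℤ) (D : GrMod.{u, u} 𝒜) (j : ℤ)
    {e : ℤ} (a : 𝒜 e) : extActAdd C D j (a : A) = extAct C D j e a := by
  change DirectSum.toAddMonoid _ (DirectSum.decompose 𝒜 (a : A)) = _
  rw [DirectSum.decompose_coe, DirectSum.toAddMonoid_of]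

/-- The action of `A` on `⨁ i, Ext^j(C, D(i))`. -/
noncomputable def extActRingHom (C : CochainComplex (GrMod.{u, u} 𝒜) ℤ) (D : GrMod.{u, u} 𝒜)
    (j : ℤ) : A →+* AddMonoid.End (DirectSum ℤ (ExtDeg C D j)) :=
  { extActAdd C D j with
    map_one' := by
      change extActAdd C D j ((⟨1, SetLike.GradedOne.one_mem⟩ : 𝒜 0) : A) =
        AddMonoidHom.id _
      rw [extActAdd_coe]
      refine DirectSum.addHom_ext fun i x => ?_
      rw [extAct_of]
      refine (extMap_of_eq C D j (zero_add i) (D.mulBy 0 i ⟨1, SetLike.GradedOne.one_mem⟩)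
        (𝟙 (D.twist i)) (fun y => one_smul A y) x).trans ?_
      rw [extMap_id]
      rfl
    map_mul' := by
      intro a b
      change extActAdd C D j (a * b) = (extActAdd C D j a).comp (extActAdd C D j b)
      induction a using DirectSum.Decomposition.inductionOn 𝒜 with
      | zero => rw [zero_mul, map_zero, AddMonoidHom.zero_comp]
      | add x y hx hy => rw [add_mul, map_add, hx, hy, map_add, AddMonoidHom.add_comp]
      | @homogeneous e a =>
        induction b using DirectSum.Decomposition.inductionOn 𝒜 with
        | zero => rw [mul_zero, map_zero, AddMonoidHom.comp_zero]
        | add x y hx hy => rw [mul_add, map_add, hx, hy, map_add, AddMonoidHom.comp_add]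
        | @homogeneous f b =>
          change extActAdd C D j
            ((⟨(a : A) * b, SetLike.GradedMul.mul_mem a.2 b.2⟩ : 𝒜 (e + f)) : A) = _
          rw [extActAdd_coe, extActAdd_coe, extActAdd_coe]
          refine DirectSum.addHom_ext fun i x => ?_
          rw [extAct_of]
          rw [AddMonoidHom.comp_apply, extAct_of, extAct_of, ← extMap_comp]
          exact extMap_of_eq C D j (add_assoc e f i)
            (D.mulBy (e + f) i ⟨(a : A) * b, SetLike.GradedMul.mul_mem a.2 b.2⟩)
            (D.mulBy f i b ≫ D.mulBy e (f + i) a)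
            (fun y => mul_smul (a : A) (b : A) (y : D.carrier)) x }

/-- The graded `A`-module `Ext^j(C, D) = ⨁ i, Hom(C, D(i)[j])`, for a complex `C` of graded
modules and a graded module `D`, where `Hom` is taken in the derived category of graded modules.
A homogeneous `a ∈ A` of degree `e` acts by composition with `a : D(i) ⟶ D(e+i)`. -/
noncomputable def uExt (C : CochainComplex (GrMod.{u, u} 𝒜) ℤ) (D : GrMod.{u, u} 𝒜) (j : ℤ) :
    GrMod.{u, u + 1} 𝒜 :=
  letI : Module A (DirectSum ℤ (ExtDeg C D j)) :=
    Module.compHom (DirectSum ℤ (ExtDeg C D j)) (extActRingHom C D j)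
  let deg' : ℤ → AddSubgroup (DirectSum ℤ (ExtDeg C D j)) := fun i =>
    (DirectSum.of (ExtDeg C D j) i).range
  { carrier := DirectSum ℤ (ExtDeg C D j)
    deg := deg'
    decomposition := decompositionOfProj deg'
      (fun i => (DirectSum.of (ExtDeg C D j) i).comp
        (DFinsupp.evalAddMonoidHom (β := ExtDeg C D j) i))
      (fun i x hx => by
        obtain ⟨y, rfl⟩ := hx
        exact congrArg (DirectSum.of (ExtDeg C D j) i) (DirectSum.of_eq_same i y))
      (fun i l h x hx => by
        obtain ⟨y, rfl⟩ := hx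
        exact (congrArg (DirectSum.of (ExtDeg C D j) l) (DirectSum.of_eq_of_ne i l y h)).trans
          (map_zero _))
      (fun x => by
        induction x using DirectSum.induction_on with
        | zero => exact zero_mem _
        | of i x => exact AddSubmonoid.subset_closure (Set.mem_iUnion.2 ⟨i, x, rfl⟩)
        | add x y hx hy => exact add_mem hx hy)
    gradedSMul := ⟨fun {e i a _} ha hx => by
      obtain ⟨y, rfl⟩ := hx
      refine ⟨extMap C j (D.mulBy e i ⟨a, ha⟩) y, ?_⟩
      have h1 := congrArg
        (fun g : DirectSum ℤ (ExtDeg C D j) →+ DirectSum ℤ (ExtDeg C D j) =>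
          g (DirectSum.of (ExtDeg C D j) i y)) (extActAdd_coe C D j (⟨a, ha⟩ : 𝒜 e))
      exact ((h1.trans (extAct_of C D j e ⟨a, ha⟩ i y)).symm)⟩ }

end

end GrMod

/-! ### Graded Gorenstein rings -/

/-- The graded ring `A = ⨁ 𝒜 i`, with residue module `κ = A / A_{>0}A`, is Gorenstein: its Krull dimension is
some natural number `d`, `Ext^d(κ, A) ≅ κ(a)` as graded modules for some `a`, and `Ext^i(κ, A) = 0`
for `i ≠ d`. -/
def IsGradedGorenstein {k A : Type u} [CommRing k] [CommRing A] [Algebra k A]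
    (𝒜 : ℤ → Submodule k A) [GradedAlgebra 𝒜] : Prop :=
  ∃ d : ℕ, ringKrullDim A = d ∧
    (∃ a : ℤ, GrMod.GrIso
      (GrMod.uExt ((CochainComplex.singleFunctor (GrMod.{u, u} 𝒜) 0).obj (GrMod.residue 𝒜))
        (GrMod.self 𝒜) d)
      ((GrMod.residue 𝒜).twist a)) ∧
    ∀ i : ℤ, i ≠ d → IsZero
      (GrMod.uExt ((CochainComplex.singleFunctor (GrMod.{u, u} 𝒜) 0).obj (GrMod.residue 𝒜))
        (GrMod.self 𝒜) i)

/-! ### Standard graded algebras `k[x_0, …, x_n] / I` -/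

/-- The standard grading (every variable has degree one) on `k[x_0, …, x_n]`, indexed by `ℤ`. -/
noncomputable def polyGrading (k : Type u) [Field k] (n : ℕ) :
    ℤ → Submodule k (MvPolynomial (Fin (n + 1)) k) :=
  MvPolynomial.weightedHomogeneousSubmodule k (fun _ => (1 : ℤ))

noncomputable instance (k : Type u) [Field k] (n : ℕ) : GradedAlgebra (polyGrading k n) :=
  MvPolynomial.weightedGradedAlgebra k (fun _ => (1 : ℤ))

/-- The grading induced on the quotient by a homogeneous ideal. -/
def quotGrading {k A : Type u} [CommRing k] [CommRing A] [Algebra k A] {𝒜 : ℤ → Submodule k A}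
    [GradedAlgebra 𝒜] (I : HomogeneousIdeal 𝒜) : ℤ → Submodule k (A ⧸ I.toIdeal) :=
  fun i => (𝒜 i).map (Ideal.Quotient.mkₐ k I.toIdeal).toLinearMap

noncomputable instance {k A : Type u} [CommRing k] [CommRing A] [Algebra k A]
    {𝒜 : ℤ → Submodule k A} [GradedAlgebra 𝒜] (I : HomogeneousIdeal 𝒜) :
    GradedAlgebra (quotGrading I) :=
  let q : A →+ A ⧸ I.toIdeal := (Ideal.Quotient.mk I.toIdeal).toAddMonoidHom
  { one_mem := ⟨1, SetLike.GradedOne.one_mem, rfl⟩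
    mul_mem := by
      rintro i j _ _ ⟨a, ha, rfl⟩ ⟨b, hb, rfl⟩
      exact ⟨a * b, SetLike.GradedMul.mul_mem ha hb, map_mul (Ideal.Quotient.mkₐ k I.toIdeal) a b⟩
    toDecomposition := decompositionOfProj (quotGrading I)
      (fun i => QuotientAddGroup.lift I.toIdeal.toAddSubgroup (q.comp (decompProj 𝒜 i))
        (fun _ hx => Ideal.Quotient.eq_zero_iff_mem.2 (I.isHomogeneous i hx)))
      (fun i x hx => by
        obtain ⟨y, hy, rfl⟩ := hx
        exact congrArg q (decompProj_same 𝒜 i y hy))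
      (fun i j h x hx => by
        obtain ⟨y, hy, rfl⟩ := hx
        exact (congrArg q (decompProj_ne 𝒜 i j h y hy)).trans (map_zero _))
      (fun x => by
        obtain ⟨y, rfl⟩ := Ideal.Quotient.mk_surjective x
        obtain ⟨s, hs⟩ := sum_decompProj 𝒜 y
        rw [hs, map_sum]
        exact sum_mem fun i _ => AddSubmonoid.subset_closure
          (Set.mem_iUnion.2 ⟨i, _, decompProj_mem 𝒜 i y, rfl⟩)) }

/-! Write `A` for the graded ring. The two bounds have different causes. The lower one is formal: in
the derived category `C` lies in degrees `≤ t`, while `A(i)[j]` lies in degrees `≥ -j`, so every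
morphism between them vanishes once `t < -j`.

For the upper one, truncation triangles reduce a complex with cohomology in `[s, t]` to its shifted
cohomology modules (`DerivedCategory.eq_zero_of_forall_singleFunctor`). These are finitely generated
because `A` is Noetherian, so it suffices that `Ext^n(M, A(l)) = 0` for all finitely generated
graded `M`, all `n > d` and all twists `l`. This is `subsingleton_ext_self_of_residue`, a dévissage
to the residue module, where the Gorenstein hypothesis gives the vanishing.

By extensions `M` may be taken cyclic with a homogeneous generator `x`, and Noetherian induction
runs on the annihilator of `x`. If all elements of positive degree kill `x`, then `M` is zero or a
twist of the residue module. Otherwise some homogeneous `r` of degree `e > 0` has `r x ≠ 0`, and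
`M/rM` has a larger annihilator. If `r` is a zero divisor on `M`, so has `rM`, and `M` is an
extension of the two. If `r` is injective on `M`, the long exact sequence shows that vanishing of
`Ext^n(M, A(l))` implies that of `Ext^n(M, A(l + e))`. The graded module `Ext^n(M, A)` is bounded
below (`exists_forall_subsingleton_ext`), so vanishing climbs from very negative `l` to every `l`.
No finiteness of Ext and no Nakayama argument is needed. -/

namespace GrMod

/-! ### Exactness and twists of graded modules -/

section

variable {k A : Type u} [CommRing k] [CommRing A] [Algebra k A] {𝒜 : ℤ → Submodule k A}

theorem isZero_of_subsingleton (M : GrMod.{u, v} 𝒜) [Subsingleton M.carrier] : IsZero M :=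
  (IsZero.iff_id_eq_zero M).2 (hom_ext fun _ => Subsingleton.elim _ _)

theorem subsingleton_of_isZero {M : GrMod.{u, v} 𝒜} (h : IsZero M) : Subsingleton M.carrier := by
  refine subsingleton_of_forall_eq 0 fun x => ?_
  exact congrArg (fun f : M ⟶ M => lin f x) ((IsZero.iff_id_eq_zero M).1 h)

theorem mono_of_injective {M N : GrMod.{u, v} 𝒜} (f : M ⟶ N)
    (hf : Function.Injective (lin f)) : Mono f :=
  ⟨fun _ _ w => hom_ext fun x => hf (congrArg (fun φ => lin φ x) w)⟩

theorem epi_of_surjective {M N : GrMod.{u, v} 𝒜} (f : M ⟶ N)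
    (hf : Function.Surjective (lin f)) : Epi f :=
  ⟨fun _ _ w => hom_ext fun y => by
    obtain ⟨x, rfl⟩ := hf y
    exact congrArg (fun φ => lin φ x) w⟩

theorem isIso_of_bijective {M N : GrMod.{u, v} 𝒜} (f : M ⟶ N)
    (hf : Function.Bijective (lin f)) : IsIso f := by
  have := mono_of_injective f hf.1
  have := epi_of_surjective f hf.2
  exact isIso_of_mono_of_epi f

theorem shortExact_of_exact {K M N : GrMod.{u, v} 𝒜} (f : K ⟶ M) (g : M ⟶ N) (w : f ≫ g = 0)
    (hf : Function.Injective (lin f)) (hg : Function.Surjective (lin g))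
    (ex : ∀ x, lin g x = 0 → ∃ y, lin f y = x) : (ShortComplex.mk f g w).ShortExact where
  exact := ShortComplex.exact_of_f_is_kernel _ (isKernelOfExact f g w hf ex)
  mono_f := mono_of_injective f hf
  epi_g := epi_of_surjective g hg

/-- The inclusion of a homogeneous submodule. -/
noncomputable def subι (M : GrMod.{u, v} 𝒜) (N : Submodule A M.carrier)
    (hN : N.IsHomogeneous M.deg) : M.sub N hN ⟶ M :=
  mkHom (M := M.sub N hN) N.subtype (fun _ _ hx => hx)

/-- The projection onto the quotient by a homogeneous submodule. -/
noncomputable def quotπ (M : GrMod.{u, v} 𝒜) (N : Submodule A M.carrier)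
    (hN : N.IsHomogeneous M.deg) : M ⟶ M.quot N hN :=
  mkHom (N := M.quot N hN) N.mkQ (fun _ x hx => ⟨x, hx, rfl⟩)

theorem subι_quotπ (M : GrMod.{u, v} 𝒜) (N : Submodule A M.carrier)
    (hN : N.IsHomogeneous M.deg) : M.subι N hN ≫ M.quotπ N hN = 0 :=
  hom_ext fun x => (Submodule.Quotient.mk_eq_zero N).2 x.2

theorem sub_quot_shortExact (M : GrMod.{u, v} 𝒜) (N : Submodule A M.carrier)
    (hN : N.IsHomogeneous M.deg) :
    (ShortComplex.mk _ _ (M.subι_quotπ N hN)).ShortExact :=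
  shortExact_of_exact _ _ _ Subtype.val_injective (Submodule.mkQ_surjective N)
    (fun x hx => ⟨⟨x, (Submodule.Quotient.mk_eq_zero N).1 hx⟩, rfl⟩)

theorem mem_deg_of_eq (M : GrMod.{u, v} 𝒜) {i j : ℤ} (h : i = j) {x : M.carrier}
    (hx : x ∈ M.deg i) : x ∈ M.deg j := h ▸ hx

/-- The twist as a functor. -/
noncomputable def twistFunctor (a : ℤ) : GrMod.{u, v} 𝒜 ⥤ GrMod.{u, v} 𝒜 where
  obj M := M.twist a
  map {M N} f := mkHom (M := M.twist a) (N := N.twist a) (lin (M := M) (N := N) f)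
    (fun i _ hx => lin_mem (M := M) (N := N) (i := i + a) f hx)

/-- Consecutive twists add up. -/
noncomputable def twistTwistIso (M : GrMod.{u, v} 𝒜) (a b c : ℤ) (h : a + b = c) :
    (M.twist a).twist b ≅ M.twist c where
  hom := mkHom (M := (M.twist a).twist b) (N := M.twist c) (LinearMap.id (M := M.carrier))
    fun i _ hx => M.mem_deg_of_eq (i := i + b + a) (j := i + c) (by lia) hx
  inv := mkHom (N := (M.twist a).twist b) (M := M.twist c) (LinearMap.id (M := M.carrier))
    fun i _ hx => M.mem_deg_of_eq (i := i + c) (j := i + b + a) (by lia) hx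

/-- Twisting by zero changes nothing. -/
noncomputable def twistZeroIso (M : GrMod.{u, v} 𝒜) : M.twist 0 ≅ M where
  hom := mkHom (M := M.twist 0) (LinearMap.id (M := M.carrier))
    fun i _ hx => M.mem_deg_of_eq (i := i + 0) (j := i) (by lia) hx
  inv := mkHom (N := M.twist 0) (LinearMap.id (M := M.carrier))
    fun i _ hx => M.mem_deg_of_eq (i := i) (j := i + 0) (by lia) hx

/-- Opposite twists are inverse to each other. -/
noncomputable def twistEquivalence (a : ℤ) : GrMod.{u, v} 𝒜 ≌ GrMod.{u, v} 𝒜 :=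
  CategoryTheory.Equivalence.mk (twistFunctor a) (twistFunctor (-a))
    (NatIso.ofComponents
      (fun M => (twistZeroIso M).symm ≪≫ (twistTwistIso M a (-a) 0 (by ring)).symm)
      -- Twists do not change the underlying modules and maps, and the comparison isomorphisms are
      -- identities there, so naturality is definitional.
      (fun _ => rfl))
    (NatIso.ofComponents
      (fun M => twistTwistIso M (-a) a 0 (by ring) ≪≫ twistZeroIso M)
      (fun _ => rfl))

instance (a : ℤ) : (twistFunctor a : GrMod.{u, v} 𝒜 ⥤ GrMod.{u, v} 𝒜).IsEquivalence :=
  (twistEquivalence (𝒜 := 𝒜) a).isEquivalence_functor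

instance (a : ℤ) : (twistFunctor a : GrMod.{u, v} 𝒜 ⥤ GrMod.{u, v} 𝒜).Additive where
  map_add := rfl

end

end GrMod

/-! ### Exact functors and vanishing of Ext -/

/-- An exact functor with an exact left inverse is faithful on derived categories. -/
theorem CategoryTheory.Functor.faithful_mapDerivedCategory
    {C : Type*} [Category* C] [Abelian C] [HasDerivedCategory C]
    {D : Type*} [Category* D] [Abelian D] [HasDerivedCategory D]
    (F : C ⥤ D) [F.Additive] [PreservesFiniteLimits F] [PreservesFiniteColimits F]
    (G : D ⥤ C) [G.Additive] [PreservesFiniteLimits G] [PreservesFiniteColimits G]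
    (e : F ⋙ G ≅ 𝟭 C) : F.mapDerivedCategory.Faithful := by
  let W := HomologicalComplex.quasiIso C (ComplexShape.up ℤ)
  let α : F.mapHomologicalComplex (ComplexShape.up ℤ) ⋙
      G.mapHomologicalComplex (ComplexShape.up ℤ) ≅ 𝟭 _ :=
    NatIso.mapHomologicalComplex e _ ≪≫ Functor.mapHomologicalComplexIdIso C _
  let β : DerivedCategory.Q ⋙ F.mapDerivedCategory ⋙ G.mapDerivedCategory ≅
      DerivedCategory.Q ⋙ 𝟭 _ :=
    (Functor.associator _ _ _).symm ≪≫
      Functor.isoWhiskerRight F.mapDerivedCategoryFactors _ ≪≫ Functor.associator _ _ _ ≪≫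
      Functor.isoWhiskerLeft _ G.mapDerivedCategoryFactors ≪≫ (Functor.associator _ _ _).symm ≪≫
      Functor.isoWhiskerRight α _ ≪≫ Functor.leftUnitor _ ≪≫ (Functor.rightUnitor _).symm
  -- The isomorphism `β` holds after composing with the localization functor `Q`, hence descends to
  -- the derived category.
  let γ : F.mapDerivedCategory ⋙ G.mapDerivedCategory ≅ 𝟭 (DerivedCategory C) :=
    Localization.liftNatIso DerivedCategory.Q W _ _ _ _ β
  have : (F.mapDerivedCategory ⋙ G.mapDerivedCategory).Faithful :=
    Functor.Faithful.of_iso γ.symm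
  exact Functor.Faithful.of_comp _ G.mapDerivedCategory

/-- An exact functor with an exact left inverse is injective on `Ext` groups. -/
theorem CategoryTheory.Functor.subsingleton_ext
    {C : Type*} [Category* C] [Abelian C] [HasDerivedCategory C] [HasExt.{w} C]
    {D : Type*} [Category* D] [Abelian D] [HasDerivedCategory D] [HasExt.{v} D]
    (F : C ⥤ D) [F.Additive] [PreservesFiniteLimits F] [PreservesFiniteColimits F]
    (G : D ⥤ C) [G.Additive] [PreservesFiniteLimits G] [PreservesFiniteColimits G]
    (e : F ⋙ G ≅ 𝟭 C) {X Y : C} {n : ℕ} (h : Subsingleton (Abelian.Ext (F.obj X) (F.obj Y) n)) :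
    Subsingleton (Abelian.Ext X Y n) := by
  have := F.faithful_mapDerivedCategory G e
  refine ⟨fun x y => ?_⟩
  have hxy : x.mapExactFunctor F = y.mapExactFunctor F := Subsingleton.elim _ _
  have h2 := congrArg (fun z => Abelian.Ext.hom z) hxy
  -- On an Ext class the induced map is `F.mapDerivedCategory` up to composition with isomorphisms
  -- on both sides; these cancel, and faithfulness finishes.
  simp only [Abelian.Ext.mapExactFunctor_hom, cancel_epi, cancel_mono] at h2
  apply Abelian.Ext.ext
  unfold ShiftedHom.map at h2
  rw [cancel_mono] at h2
  exact F.mapDerivedCategory.map_injective h2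

theorem CategoryTheory.Abelian.Ext.subsingleton_of_iso
    {C : Type*} [Category* C] [Abelian C] [HasExt.{w} C] {X X' Y Y' : C} (e : X ≅ X')
    (f : Y ≅ Y') {n : ℕ} (h : Subsingleton (Abelian.Ext X Y n)) :
    Subsingleton (Abelian.Ext X' Y' n) := by
  let g (z : Abelian.Ext X' Y' n) : Abelian.Ext X Y n :=
    ((mk₀ e.hom).comp z (zero_add n)).comp (mk₀ f.inv) (add_zero n)
  have key : ∀ z : Abelian.Ext X' Y' n,
      z = ((mk₀ e.inv).comp (g z) (zero_add n)).comp (mk₀ f.hom) (add_zero n) := by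
    intro z
    simp [g]
  exact ⟨fun x y => by rw [key x, key y, Subsingleton.elim (g x) (g y)]⟩

theorem CategoryTheory.Abelian.Ext.subsingleton_of_shortExact
    {C : Type*} [Category* C] [Abelian C] [HasExt.{w} C] {S : ShortComplex C} (hS : S.ShortExact)
    (Y : C) {n : ℕ} (h₁ : Subsingleton (Abelian.Ext S.X₁ Y n))
    (h₃ : Subsingleton (Abelian.Ext S.X₃ Y n)) : Subsingleton (Abelian.Ext S.X₂ Y n) := by
  refine subsingleton_of_forall_eq 0 fun x => ?_
  obtain ⟨y, rfl⟩ := contravariant_sequence_exact₂ hS Y x (Subsingleton.elim _ _)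
  rw [Subsingleton.elim y 0, comp_zero]

/-- The stretch `Ext^n(X₂) → Ext^n(X₁) → Ext^{n+1}(X₃)` of the long exact sequence. It carries
vanishing from one twist to the next when multiplication by `r` is injective. -/
theorem CategoryTheory.Abelian.Ext.subsingleton_X₁
    {C : Type*} [Category* C] [Abelian C] [HasExt.{w} C] {S : ShortComplex C} (hS : S.ShortExact)
    (Y : C) {n : ℕ} (h₂ : Subsingleton (Abelian.Ext S.X₂ Y n))
    (h₃ : Subsingleton (Abelian.Ext S.X₃ Y (n + 1))) : Subsingleton (Abelian.Ext S.X₁ Y n) := by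
  refine subsingleton_of_forall_eq 0 fun x => ?_
  obtain ⟨y, rfl⟩ := contravariant_sequence_exact₁ hS Y x (add_comm 1 n) (Subsingleton.elim _ _)
  rw [Subsingleton.elim y 0, comp_zero]

/-- The stretch `Ext^n(X₁) → Ext^{n+1}(X₃) → Ext^{n+1}(X₂)`; with `X₂` projective this is dimension
shifting. -/
theorem CategoryTheory.Abelian.Ext.subsingleton_X₃
    {C : Type*} [Category* C] [Abelian C] [HasExt.{w} C] {S : ShortComplex C} (hS : S.ShortExact)
    (Y : C) {n : ℕ} (h₁ : Subsingleton (Abelian.Ext S.X₁ Y n))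
    (h₂ : Subsingleton (Abelian.Ext S.X₂ Y (n + 1))) :
    Subsingleton (Abelian.Ext S.X₃ Y (n + 1)) := by
  refine subsingleton_of_forall_eq 0 fun x => ?_
  obtain ⟨y, rfl⟩ := contravariant_sequence_exact₃ hS Y x (Subsingleton.elim _ _) (add_comm 1 n)
  rw [Subsingleton.elim y 0, comp_zero]

/-! ### Ext groups of twisted modules -/

namespace GrMod

variable {k A : Type u} [CommRing k] [CommRing A] [Algebra k A] {𝒜 : ℤ → Submodule k A}

/-- The universe is that of the morphisms in the chosen derived category, so that Ext groups can be
compared with `ExtDeg`. -/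
instance : HasExt.{u + 1} (GrMod.{u, u} 𝒜) := hasExt_of_hasDerivedCategory _

theorem subsingleton_ext_of_twist {M N : GrMod.{u, u} 𝒜} {n : ℕ} (a : ℤ)
    (h : Subsingleton (Abelian.Ext (M.twist a) (N.twist a) n)) :
    Subsingleton (Abelian.Ext M N n) :=
  Functor.subsingleton_ext (twistFunctor a) (twistFunctor (-a))
    (twistEquivalence (𝒜 := 𝒜) a).unitIso.symm h

theorem subsingleton_ext_twist {M N : GrMod.{u, u} 𝒜} {n : ℕ} (a b c : ℤ) (hc : c + a = b)
    (h : Subsingleton (Abelian.Ext M (N.twist c) n)) :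
    Subsingleton (Abelian.Ext (M.twist a) (N.twist b) n) :=
  subsingleton_ext_of_twist (-a) <| Abelian.Ext.subsingleton_of_iso
    ((twistZeroIso M).symm ≪≫ (twistTwistIso M a (-a) 0 (by ring)).symm)
    (twistTwistIso N b (-a) c (by lia)).symm h

end GrMod

/-! ### Finitely generated graded modules and lower bounds for Ext -/

namespace GrMod

variable {k A : Type u} [CommRing k] [CommRing A] [Algebra k A] {𝒜 : ℤ → Submodule k A}

theorem decompProj_smul (M : GrMod.{u, v} 𝒜) {e : ℤ} {r : A} (hr : r ∈ 𝒜 e) (i : ℤ)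
    (y : M.carrier) : decompProj M.deg i (r • y) = r • decompProj M.deg (i - e) y := by
  induction y using DirectSum.Decomposition.inductionOn M.deg with
  | zero => simp
  | @homogeneous j m =>
    have hm : r • (m : M.carrier) ∈ M.deg (e + j) := M.smul_mem_deg rfl hr m.2
    by_cases h : i = e + j
    · subst h
      rw [decompProj_same _ _ _ hm, add_sub_cancel_left, decompProj_same _ _ _ m.2]
    · rw [decompProj_ne _ _ _ h _ hm, decompProj_ne _ _ _ (by lia) _ m.2, smul_zero]
  | add x y hx hy => simp only [map_add, smul_add, hx, hy]

/-- Splitting a scalar into homogeneous parts reduces the claim for `r • x` to `decompProj_smul`, by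
which a homogeneous scalar only shifts the index of the projection. -/
theorem span_isHomogeneous [GradedAlgebra 𝒜] (M : GrMod.{u, v} 𝒜) (s : Set M.carrier)
    (hs : ∀ x ∈ s, ∃ a, x ∈ M.deg a) : (Submodule.span A s).IsHomogeneous M.deg := by
  suffices h : ∀ x ∈ Submodule.span A s, ∀ i, decompProj M.deg i x ∈ Submodule.span A s from
    fun i x hx => h x hx i
  intro x hx
  induction hx using Submodule.span_induction with
  | mem x hx =>
    intro i
    obtain ⟨a, ha⟩ := hs x hx
    by_cases h : i = a
    · subst h
      rw [decompProj_same _ _ _ ha]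
      exact Submodule.subset_span hx
    · rw [decompProj_ne _ _ _ h _ ha]
      exact zero_mem _
  | zero => intro i; rw [map_zero]; exact zero_mem _
  | add x y _ _ hx hy => intro i; rw [map_add]; exact add_mem (hx i) (hy i)
  | smul r x _ hx =>
    induction r using DirectSum.Decomposition.inductionOn 𝒜 with
    | zero => intro i; rw [zero_smul, map_zero]; exact zero_mem _
    | @homogeneous e r =>
      intro i
      rw [M.decompProj_smul r.2]
      exact Submodule.smul_mem _ _ (hx _)
    | add r r' hr hr' => intro i; rw [add_smul, map_add]; exact add_mem (hr i) (hr' i)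

/-- An induction principle for finitely generated graded modules. -/
theorem induction_of_finite [GradedAlgebra 𝒜] {P : GrMod.{u, v} 𝒜 → Prop}
    (cyclic : ∀ (M : GrMod.{u, v} 𝒜) (a : ℤ) (x : M.carrier), x ∈ M.deg a →
      Submodule.span A {x} = ⊤ → P M)
    (ext : ∀ S : ShortComplex (GrMod.{u, v} 𝒜), S.ShortExact → P S.X₁ → P S.X₃ → P S.X₂)
    (M : GrMod.{u, v} 𝒜) [Module.Finite A M.carrier] : P M := by
  -- Induction on the number of homogeneous generators: dividing by the span of all but the last
  -- leaves a cyclic quotient.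
  have key : ∀ (n : ℕ) (M : GrMod.{u, v} 𝒜) (v : Fin n → M.carrier),
      (∀ i, ∃ a, v i ∈ M.deg a) → Submodule.span A (Set.range v) = ⊤ → P M := by
    intro n
    induction n with
    | zero =>
      intro M v _ hv
      -- With no generators the module is zero, hence cyclic on the generator `0`, placed in degree
      -- `0` arbitrarily.
      refine cyclic M 0 0 (zero_mem _) ?_
      rw [← hv]
      simp
    | succ n ih =>
      intro M v hv hs
      let N := Submodule.span A (Set.range fun i : Fin n => v i.castSucc)
      have hN : N.IsHomogeneous M.deg :=
        M.span_isHomogeneous _ (by rintro _ ⟨i, rfl⟩; exact hv _)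
      refine ext _ (M.sub_quot_shortExact N hN) ?_ ?_
      · refine ih (M.sub N hN) (fun i => (⟨v i.castSucc, Submodule.subset_span ⟨i, rfl⟩⟩ : N))
          (fun i => hv i.castSucc) ?_
        change Submodule.span A (Set.range fun i : Fin n =>
          (⟨v i.castSucc, Submodule.subset_span ⟨i, rfl⟩⟩ : N)) = ⊤
        apply Submodule.map_injective_of_injective N.injective_subtype
        rw [Submodule.map_span, Submodule.map_top, Submodule.range_subtype, ← Set.range_comp]
        rfl
      · obtain ⟨a, ha⟩ := hv (Fin.last n)
        refine cyclic (M.quot N hN) a (N.mkQ (v (Fin.last n))) ⟨_, ha, rfl⟩ ?_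
        change Submodule.span A {N.mkQ (v (Fin.last n))} = ⊤
        rw [eq_top_iff, ← Submodule.range_mkQ N, LinearMap.range_eq_map, ← hs,
          Submodule.map_span, Submodule.span_le]
        rintro _ ⟨_, ⟨i, rfl⟩, rfl⟩
        induction i using Fin.lastCases with
        | last => exact Submodule.subset_span rfl
        | cast i =>
          have : N.mkQ (v i.castSucc) = 0 :=
            (Submodule.Quotient.mk_eq_zero N).2 (Submodule.subset_span ⟨i, rfl⟩)
          rw [this]
          exact zero_mem _
  classical
  obtain ⟨s, hs⟩ := Module.Finite.fg_top (R := A) (M := M.carrier)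
  choose t ht using fun x : M.carrier => sum_decompProj M.deg x
  -- The homogeneous components of a finite generating set generate as well, and there are finitely
  -- many of them.
  let T : Finset M.carrier := s.biUnion fun x => (t x).image fun i => decompProj M.deg i x
  refine key T.card M (fun i => T.equivFin.symm i) (fun i => ?_) ?_
  · obtain ⟨x, -, hx⟩ := Finset.mem_biUnion.1 (T.equivFin.symm i).2
    obtain ⟨j, -, hj⟩ := Finset.mem_image.1 hx
    exact ⟨j, hj ▸ decompProj_mem M.deg j x⟩
  · have hr : (Set.range fun i => (T.equivFin.symm i : M.carrier)) = T := by
      ext x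
      refine ⟨?_, fun hx => ⟨T.equivFin ⟨x, hx⟩, by simp⟩⟩
      rintro ⟨i, rfl⟩
      exact (T.equivFin.symm i).2
    rw [hr, eq_top_iff, ← hs, Submodule.span_le]
    intro x hx
    rw [ht x]
    exact sum_mem fun i hi => Submodule.subset_span
      (Finset.mem_biUnion.2 ⟨x, hx, Finset.mem_image_of_mem _ hi⟩)

/-- The morphism `A(-a) ⟶ M` sending `1` to a homogeneous element of degree `a`. -/
noncomputable def selfTwistHom [GradedAlgebra 𝒜] (M : GrMod.{u, u} 𝒜) {a b : ℤ} (h : a + b = 0)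
    (x : M.carrier) (hx : x ∈ M.deg a) : (self 𝒜).twist b ⟶ M :=
  mkHom (M := (self 𝒜).twist b) (LinearMap.toSpanSingleton A M.carrier x)
    (fun i r hr => M.smul_mem_deg (e := i + b) (i := a) (by lia) (a := r) hr hx)

theorem one_mem_self_deg [GradedAlgebra 𝒜] {b : ℤ} :
    (show ((self 𝒜).twist b).carrier from (1 : A)) ∈ ((self 𝒜).twist b).deg (-b) := by
  have : (1 : A) ∈ 𝒜 0 := SetLike.GradedOne.one_mem
  exact (self 𝒜).mem_deg_of_eq (neg_add_cancel b).symm this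

/-- A morphism out of `A(b)` is determined by the image of `1`, which has degree `-b`. A preimage of
it under a surjection need not be homogeneous, but its component in degree `-b` is again a preimage.
-/
instance [GradedAlgebra 𝒜] (b : ℤ) : Projective ((self 𝒜).twist b) where
  factors {N M} f e he := by
    let y : M.carrier := lin f (show ((self 𝒜).twist b).carrier from (1 : A))
    have hy : y ∈ M.deg (-b) := lin_mem f one_mem_self_deg
    obtain ⟨x, hx⟩ := surjective_of_epi e y
    have hx' : lin e (decompProj N.deg (-b) x) = y := by
      rw [lin_proj, hx, decompProj_same _ _ _ hy]
    refine ⟨selfTwistHom N (neg_add_cancel b) _ (decompProj_mem _ _ x), hom_ext fun r => ?_⟩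
    have h : lin e ((show A from r) • decompProj N.deg (-b) x) = (show A from r) • y := by
      rw [map_smul, hx']
    refine h.trans ((map_smul (lin f) (show A from r) _).symm.trans ?_)
    exact congrArg (lin f) (mul_one (show A from r))

/-- For a finitely generated graded module `M` over a Noetherian nonnegatively graded ring `A`,
the graded module `Ext^n(M, A)` is bounded below. -/
theorem exists_forall_subsingleton_ext [GradedAlgebra 𝒜] [IsNoetherianRing A]
    (h𝒜 : ∀ e < 0, 𝒜 e = ⊥) (n : ℕ) (M : GrMod.{u, u} 𝒜) [hM : Module.Finite A M.carrier] :
    ∃ B : ℤ, ∀ l < B, Subsingleton (Abelian.Ext M ((self 𝒜).twist l) n) := by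
  induction n generalizing M with
  | zero =>
    refine induction_of_finite (P := fun M => ∃ B : ℤ, ∀ l < B,
      Subsingleton (Abelian.Ext M ((self 𝒜).twist l) 0)) (fun M a x hx hs => ?_)
      (fun S hS h₁ h₃ => ?_) M
    -- A degree-preserving map to `A(l)` sends the generator into degree `a + l` of `A`, which is
    -- zero when `l < -a`.
    · refine ⟨-a, fun l hl => ?_⟩
      refine Abelian.Ext.homEquiv₀.subsingleton_congr.2 (subsingleton_of_forall_eq 0 fun f => ?_)
      have hz : lin f x = 0 := by
        have : lin f x ∈ 𝒜 (a + l) := lin_mem f hx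
        rw [h𝒜 _ (by lia)] at this
        exact this
      have : lin f = 0 := LinearMap.ext_on_range (v := fun _ : Unit => x) (by simpa using hs)
        (fun _ => hz)
      exact hom_ext fun y => LinearMap.congr_fun this y
    · obtain ⟨B₁, h₁⟩ := h₁
      obtain ⟨B₃, h₃⟩ := h₃
      exact ⟨min B₁ B₃, fun l hl => Abelian.Ext.subsingleton_of_shortExact hS _
        (h₁ l (lt_min_iff.1 hl).1) (h₃ l (lt_min_iff.1 hl).2)⟩
  | succ n ih =>
    refine induction_of_finite (P := fun M => ∃ B : ℤ, ∀ l < B,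
      Subsingleton (Abelian.Ext M ((self 𝒜).twist l) (n + 1))) (fun M a x hx hs => ?_)
      (fun S hS h₁ h₃ => ?_) M
    -- Present `M` as a quotient of the projective module `A(-a)`. The kernel is finitely generated
    -- by Noetherianity, and a bound for its `Ext^n` serves for `Ext^{n+1}` of `M`.
    · let φ := selfTwistHom M (add_neg_cancel a) x hx
      have hφ : Function.Surjective (lin φ) := by
        intro y
        have hy : y ∈ Submodule.span A {x} := hs ▸ Submodule.mem_top
        obtain ⟨r, hr⟩ := Submodule.mem_span_singleton.1 hy
        exact ⟨r, hr⟩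
      have : Module.Finite A (ker φ).carrier :=
        inferInstanceAs (Module.Finite A (LinearMap.ker (LinearMap.toSpanSingleton A M.carrier x)))
      obtain ⟨B, hB⟩ := ih (ker φ)
      exact ⟨B, fun l hl => Abelian.Ext.subsingleton_X₃
        (shortExact_of_exact (kerι φ) φ (kerι_comp φ) Subtype.val_injective hφ
          (fun x hx => ⟨⟨x, hx⟩, rfl⟩)) _ (hB l hl)
        (Abelian.Ext.subsingleton_of_projective _ _ _)⟩
    · obtain ⟨B₁, h₁⟩ := h₁
      obtain ⟨B₃, h₃⟩ := h₃
      exact ⟨min B₁ B₃, fun l hl => Abelian.Ext.subsingleton_of_shortExact hS _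
        (h₁ l (lt_min_iff.1 hl).1) (h₃ l (lt_min_iff.1 hl).2)⟩

end GrMod

/-! ### Reduction to the residue module -/

namespace GrMod

variable {k A : Type u} [CommRing k] [CommRing A] [Algebra k A] {𝒜 : ℤ → Submodule k A}

/-- A nonzero cyclic graded module annihilated by all elements of positive degree is a twist of
the residue field. -/
theorem nonempty_iso_residue_twist [GradedAlgebra 𝒜] (hneg : ∀ e < 0, 𝒜 e = ⊥)
    (hunit : ∀ r ∈ 𝒜 0, r ≠ 0 → IsUnit r) (M : GrMod.{u, u} 𝒜) (a : ℤ) (x : M.carrier)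
    (hx : x ∈ M.deg a) (hs : Submodule.span A {x} = ⊤) (hx0 : x ≠ 0)
    (hpos : ∀ e > 0, ∀ r ∈ 𝒜 e, r • x = 0) :
    Nonempty ((residue 𝒜).twist (-a) ≅ M) := by
  have hle : irrelevant 𝒜 ≤ LinearMap.ker (LinearMap.toSpanSingleton A M.carrier x) := by
    refine Ideal.span_le.2 ?_
    rintro r ⟨e, he, hr⟩
    exact hpos e he r hr
  -- If `r` kills `x`, so does its degree-zero part, because the other parts lie in the irrelevant
  -- ideal. A nonzero degree-zero element is a unit and cannot kill `x ≠ 0`, so that part vanishes.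
  have hker : LinearMap.ker (LinearMap.toSpanSingleton A M.carrier x) ≤ irrelevant 𝒜 := by
    intro r hr
    have hsub : r - decompProj 𝒜 0 r ∈ irrelevant 𝒜 := by
      obtain ⟨s, hs⟩ := sum_decompProj 𝒜 r
      have h0 : decompProj 𝒜 0 r = ∑ i ∈ s, decompProj 𝒜 0 (decompProj 𝒜 i r) := by
        conv_lhs => rw [hs, map_sum]
      have h1 : r - decompProj 𝒜 0 r =
          ∑ i ∈ s, (decompProj 𝒜 i r - decompProj 𝒜 0 (decompProj 𝒜 i r)) := by
        rw [Finset.sum_sub_distrib, ← hs, ← h0]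
      rw [h1]
      refine sum_mem fun i _ => ?_
      rcases lt_trichotomy i 0 with hi | rfl | hi
      · have : decompProj 𝒜 i r ∈ 𝒜 i := decompProj_mem 𝒜 i r
        rw [hneg i hi] at this
        rw [(Submodule.mem_bot k).1 this, map_zero, sub_zero]
        exact zero_mem _
      · rw [decompProj_same 𝒜 0 _ (decompProj_mem 𝒜 0 r), sub_self]
        exact zero_mem _
      · rw [decompProj_ne 𝒜 i 0 hi.ne _ (decompProj_mem 𝒜 i r), sub_zero]
        exact Ideal.subset_span ⟨i, hi, decompProj_mem 𝒜 i r⟩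
    have h0 : decompProj 𝒜 0 r • x = 0 := by
      have h1 : r • x = 0 := hr
      have h2 : (r - decompProj 𝒜 0 r) • x = 0 := hle hsub
      rwa [sub_smul, h1, zero_sub, neg_eq_zero] at h2
    have : decompProj 𝒜 0 r = 0 := by
      by_contra hne
      exact hx0 ((hunit _ (decompProj_mem 𝒜 0 r) hne).smul_eq_zero.1 h0)
    rwa [this, sub_zero] at hsub
  let ψ : (residue 𝒜).twist (-a) ⟶ M := mkHom (M := (residue 𝒜).twist (-a))
    (Submodule.liftQ (irrelevant 𝒜) (LinearMap.toSpanSingleton A M.carrier x) hle) (by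
      rintro i _ ⟨r, hr, rfl⟩
      exact M.smul_mem_deg (e := i + -a) (i := a) (by lia) (a := r) hr hx)
  have hψ : Function.Bijective (lin ψ) := by
    constructor
    · exact LinearMap.ker_eq_bot.1 (Submodule.ker_liftQ_eq_bot _ _ hle hker)
    · intro y
      have hy : y ∈ Submodule.span A {x} := hs ▸ Submodule.mem_top
      obtain ⟨r, hr⟩ := Submodule.mem_span_singleton.1 hy
      exact ⟨Submodule.Quotient.mk r, hr⟩
  have := isIso_of_bijective ψ hψ
  exact ⟨asIso ψ⟩

/-- Over a Noetherian graded ring, nonnegatively graded with a field in degree zero, the vanishing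
of `Ext^n(-, A)` on the residue field for all `n > d` implies it on all finitely generated graded
modules. -/
theorem subsingleton_ext_self_of_residue [GradedAlgebra 𝒜] [IsNoetherianRing A]
    (hneg : ∀ e < 0, 𝒜 e = ⊥) (hunit : ∀ r ∈ 𝒜 0, r ≠ 0 → IsUnit r) (d : ℕ)
    (hres : ∀ n > d, ∀ l, Subsingleton (Abelian.Ext (residue 𝒜) ((self 𝒜).twist l) n))
    (M : GrMod.{u, u} 𝒜) [Module.Finite A M.carrier] :
    ∀ n > d, ∀ l, Subsingleton (Abelian.Ext M ((self 𝒜).twist l) n) := by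
  refine induction_of_finite (P := fun M => ∀ n > d, ∀ l,
      Subsingleton (Abelian.Ext M ((self 𝒜).twist l) n)) (fun M a x hx hs => ?_)
      (fun S hS h₁ h₃ n hn l =>
        Abelian.Ext.subsingleton_of_shortExact hS _ (h₁ n hn l) (h₃ n hn l)) M
  -- Annihilators of generators are ideals of the fixed ring `A`, so Noetherian induction can run on
  -- them while the module varies.
  obtain ⟨J, hJ⟩ : ∃ J : Ideal A, LinearMap.ker (LinearMap.toSpanSingleton A M.carrier x) = J :=
    ⟨_, rfl⟩
  induction J using WellFoundedGT.induction generalizing M a with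
  | ind J ih =>
  have hfin : Module.Finite A M.carrier := ⟨⟨{x}, by simpa using hs⟩⟩
  have hgen (y : M.carrier) : ∃ r : A, r • x = y :=
    Submodule.mem_span_singleton.1 (hs ▸ Submodule.mem_top : y ∈ Submodule.span A {x})
  by_cases hpos : ∀ e > 0, ∀ r ∈ 𝒜 e, r • x = 0
  · intro n hn l
    by_cases hx0 : x = 0
    · have : Subsingleton M.carrier := by
        refine subsingleton_of_forall_eq 0 fun y => ?_
        obtain ⟨r, rfl⟩ := hgen y
        rw [hx0, smul_zero]
      refine subsingleton_of_forall_eq 0 fun f => ?_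
      rw [← Abelian.Ext.mk₀_id_comp f, (IsZero.iff_id_eq_zero M).1 M.isZero_of_subsingleton,
        Abelian.Ext.mk₀_zero, Abelian.Ext.zero_comp]
    · obtain ⟨e⟩ := nonempty_iso_residue_twist hneg hunit M a x hx hs hx0 hpos
      exact Abelian.Ext.subsingleton_of_iso e (Iso.refl _)
        (subsingleton_ext_twist (-a) l (l + a) (by lia) (hres n hn _))
  · push Not at hpos
    obtain ⟨e, he, r, hr, hrx⟩ := hpos
    -- The source is twisted by `-e` to make multiplication by `r` degree-preserving.
    let f : M.twist (-e) ⟶ M := mkHom (M := M.twist (-e)) (LinearMap.lsmul A M.carrier r)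
      (fun i y hy => M.smul_mem_deg (e := e) (i := i + -e) (by lia) (x := y) hr hy)
    have hfr : ∀ y : M.carrier, r • y ∈ LinearMap.range (lin f) := fun y => ⟨y, rfl⟩
    -- The cokernel `M/rM` is generated by the class of `x`, whose annihilator also contains `r`;
    -- since `r x ≠ 0`, it is strictly larger than `J`.
    have hcoker : ∀ n > d, ∀ l, Subsingleton (Abelian.Ext (coker f) ((self 𝒜).twist l) n) := by
      refine ih (LinearMap.ker (LinearMap.toSpanSingleton A (coker f).carrier
        (lin (cokerπ f) x))) ?_ (coker f) a (lin (cokerπ f) x) (lin_mem _ hx) ?_ rfl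
      · refine SetLike.lt_iff_le_and_exists.2 ⟨fun b hb => ?_, r, ?_, ?_⟩
        · have hbx : b • x = 0 := by rw [← hJ] at hb; exact hb
          change b • lin (cokerπ f) x = 0
          rw [← map_smul, hbx, map_zero]
        · change r • lin (cokerπ f) x = 0
          rw [← map_smul]
          exact (Submodule.Quotient.mk_eq_zero _).2 (hfr x)
        · rw [← hJ]
          exact hrx
      · rw [eq_top_iff]
        rintro y -
        obtain ⟨z, rfl⟩ := Submodule.mkQ_surjective (LinearMap.range (lin f)) y
        obtain ⟨b, rfl⟩ := hgen z
        exact Submodule.mem_span_singleton.2 ⟨b, (map_smul _ b x).symm⟩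
    by_cases hinj : Function.Injective (lin f)
    · have hS := shortExact_of_exact f (cokerπ f) (comp_cokerπ f) hinj
        (Submodule.mkQ_surjective _) (fun _ hx => (Submodule.Quotient.mk_eq_zero _).1 hx)
      intro n hn l
      -- In `Ext^n(M, A(l)) → Ext^n(M(-e), A(l)) → Ext^{n+1}(M/rM, A(l))` the right term vanishes,
      -- and the middle one is `Ext^n(M, A(l + e))` up to a twist.
      have step : ∀ l, Subsingleton (Abelian.Ext M ((self 𝒜).twist l) n) →
          Subsingleton (Abelian.Ext M ((self 𝒜).twist (l + e)) n) := fun l hl =>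
        subsingleton_ext_of_twist (-e) <| Abelian.Ext.subsingleton_of_iso (Iso.refl _)
          (twistTwistIso (self 𝒜) (l + e) (-e) l (by lia)).symm
          (Abelian.Ext.subsingleton_X₁ hS _ hl (hcoker (n + 1) (by lia) l))
      obtain ⟨B, hB⟩ := exists_forall_subsingleton_ext hneg n M
      -- As `e ≥ 1`, going down from `l` to `l - e` lowers the required `m` by at least one, until
      -- the range `l < B` is reached.
      have iter : ∀ (m : ℕ) (l : ℤ), l < B + m →
          Subsingleton (Abelian.Ext M ((self 𝒜).twist l) n) := by
        intro m
        induction m with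
        | zero => intro l hl; exact hB l (by simpa using hl)
        | succ m ihm =>
          intro l hl
          have := step (l - e) (ihm _ (by push_cast at hl; lia))
          rwa [sub_add_cancel] at this
      exact iter (l - B + 1).toNat l (by lia)
    · intro n hn l
      have hN := range_isHomogeneous f
      refine Abelian.Ext.subsingleton_of_shortExact
        (M.sub_quot_shortExact (LinearMap.range (lin f)) hN) _ ?_ (hcoker n hn l)
      let N : Submodule A M.carrier := LinearMap.range (lin f)
      let z : N := ⟨r • x, hfr x⟩
      -- The image `rM` is generated by `r x`. Its annihilator contains `J`, and strictly: a nonzero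
      -- `c x` killed by `r` gives `c ∉ J` with `c r x = 0`.
      refine ih (LinearMap.ker (LinearMap.toSpanSingleton A N z)) ?_
        (M.sub N hN) (e + a) z (M.smul_mem_deg rfl hr hx) ?_ rfl n hn l
      · obtain ⟨y, hy, hy0⟩ : ∃ y : M.carrier, r • y = 0 ∧ y ≠ 0 := by
          by_contra! h
          exact hinj (LinearMap.ker_eq_bot.1 (LinearMap.ker_eq_bot'.2 fun y hy => h y hy))
        obtain ⟨c, rfl⟩ := hgen y
        refine SetLike.lt_iff_le_and_exists.2 ⟨fun b hb => ?_, c, ?_, ?_⟩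
        · have hbx : b • x = 0 := by rw [← hJ] at hb; exact hb
          apply Subtype.ext
          change b • r • x = 0
          rw [smul_comm, hbx, smul_zero]
        · apply Subtype.ext
          change c • r • x = 0
          rw [smul_comm, hy]
        · rw [← hJ]
          exact hy0
      · change Submodule.span A {z} = (⊤ : Submodule A N)
        rw [eq_top_iff]
        rintro ⟨_, y, rfl⟩ -
        obtain ⟨b, rfl⟩ := hgen y
        refine Submodule.mem_span_singleton.2 ⟨b, Subtype.ext ?_⟩
        exact smul_comm b r x

end GrMod

/-! ### Reduction from complexes to modules -/

open Pretriangulated in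
/-- If every morphism to `Y` from `M[-n]` vanishes for `n ≥ s` and `M` in a class stable under
subobjects and quotients, then so does every morphism to `Y` from a bounded complex in degrees
`≥ s` with cohomology in that class. -/
theorem DerivedCategory.eq_zero_of_forall_singleFunctor {C : Type u} [Category.{v} C] [Abelian C]
    [HasDerivedCategory.{w} C] (P : C → Prop)
    (hmono : ∀ ⦃M N : C⦄ (f : M ⟶ N) [Mono f], P N → P M)
    (hepi : ∀ ⦃M N : C⦄ (f : M ⟶ N) [Epi f], P M → P N)
    (Y : DerivedCategory C) (s : ℤ)
    (hY : ∀ (M : C), P M → ∀ n ≥ s, ∀ f : (singleFunctor C n).obj M ⟶ Y, f = 0)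
    (t : ℤ) (X : DerivedCategory C) [X.IsGE s] [X.IsLE t]
    (hX : ∀ n, P ((homologyFunctor C n).obj X)) (f : X ⟶ Y) : f = 0 := by
  -- The induction is on a bound `m` for the number of degrees in `[s, t]`.
  obtain ⟨m, hm⟩ : ∃ m : ℕ, t < s + m := ⟨(t - s + 1).toNat, by lia⟩
  induction m generalizing t X with
  | zero =>
    have h : 𝟙 X = 0 := TStructure.t.zero_of_isLE_of_isGE (𝟙 X) t s (by simpa using hm) ‹_› ‹_›
    rw [← Category.id_comp f, h, zero_comp]
  | succ m ih =>
    by_cases hts : t < s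
    · exact ih t X hX f (by lia)
    obtain ⟨A, B, hA, hB, g, p, δ, hT⟩ :=
      TStructure.t.exists_triangle X (t - 1) t (by lia)
    have : A.IsLE (t - 1) := ⟨hA⟩
    have : B.IsGE t := ⟨hB⟩
    -- The truncations have cohomology in degrees `≤ t - 1` and `≥ t`, so a connecting map has zero
    -- source or zero target. Hence the cohomology of `A` embeds in that of `X`, and that of `B` is
    -- a quotient of it; both inherit the bounds and the class `P`.
    have hδ : ∀ n₀ n₁ h, HomologySequence.δ (Triangle.mk g p δ) n₀ n₁ h = 0 := by
      intro n₀ n₁ h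
      by_cases hn : n₀ < t
      · exact (B.isZero_of_isGE t n₀ hn).eq_of_src _ _
      · exact (A.isZero_of_isLE (t - 1) n₁ (by lia)).eq_of_tgt _ _
    have hg : ∀ n, Mono ((homologyFunctor C n).map g) := fun n =>
      (HomologySequence.mono_homologyMap_mor₁_iff _ hT (n - 1) n (by lia)).2 (hδ _ _ _)
    have hp : ∀ n, Epi ((homologyFunctor C n).map p) := fun n =>
      (HomologySequence.epi_homologyMap_mor₂_iff _ hT n (n + 1) rfl).2 (hδ _ _ _)
    have : A.IsGE s := (isGE_iff _ _).2 fun i hi =>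
      have := hg i
      IsZero.of_mono ((homologyFunctor C i).map g) (X.isZero_of_isGE s i hi)
    have : B.IsLE t := (isLE_iff _ _).2 fun i hi =>
      have := hp i
      IsZero.of_epi ((homologyFunctor C i).map p) (X.isZero_of_isLE t i hi)
    obtain ⟨M, ⟨e⟩⟩ := exists_iso_singleFunctor_obj_of_isGE_of_isLE B t
    have hM : P M := by
      have := hp t
      exact hepi ((homologyFunctor C t).map p ≫ (homologyFunctor C t).map e.hom ≫
        (singleFunctorCompHomologyFunctorIso C t).hom.app M) (hX t)
    have hgf : g ≫ f = 0 := ih (t - 1) A (fun n => have := hg n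
      hmono ((homologyFunctor C n).map g) (hX n)) _ (by lia)
    -- Since `f` vanishes on `A`, it factors through `B`, which is a single object in degree `t`.
    obtain ⟨h, hh⟩ := Triangle.yoneda_exact₂ _ hT f hgf
    have h0 : e.inv ≫ h = 0 := hY M hM t (by lia) _
    have h1 : h = 0 := (cancel_epi e.inv).1 (h0.trans comp_zero.symm)
    rw [hh, h1]
    exact comp_zero

theorem DerivedCategory.singleFunctor_hom_eq_zero {C : Type u} [Category.{v} C] [Abelian C]
    [HasDerivedCategory.{w} C] [HasExt.{w} C] {M N : C} {n j : ℤ} {m : ℕ} (hm : j + n = m)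
    (h : Subsingleton (Abelian.Ext M N m))
    (f : (singleFunctor C n).obj M ⟶ ((singleFunctor C 0).obj N)⟦j⟧) : f = 0 := by
  have : Subsingleton ((singleFunctor C 0).obj M ⟶ ((singleFunctor C 0).obj N)⟦(m : ℤ)⟧) :=
    (Abelian.Ext.homEquiv (X := M) (Y := N) (n := m)).subsingleton_congr.1 h
  -- Shifting by `n` turns a morphism `M[-n] ⟶ N[j]` into one `M ⟶ N[j + n]`, that is, a class in
  -- `Ext^m(M, N)`.
  apply (shiftFunctor (DerivedCategory C) n).map_injective
  rw [Functor.map_zero,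
    ← cancel_epi (((singleFunctors C).shiftIso n 0 n (by simp)).inv.app M),
    ← cancel_mono ((shiftFunctorAdd' (DerivedCategory C) j n m hm).inv.app
      ((singleFunctor C 0).obj N))]
  exact Subsingleton.elim _ _

/-! ### Vanishing of the graded Ext modules -/

namespace GrMod

variable {k A : Type u} [CommRing k] [CommRing A] [Algebra k A] {𝒜 : ℤ → Submodule k A}

theorem isZero_uExt [GradedAlgebra 𝒜] {C : CochainComplex (GrMod.{u, u} 𝒜) ℤ}
    {D : GrMod.{u, u} 𝒜} {j : ℤ} (h : ∀ i, ∀ x : ExtDeg C D j i, x = 0) : IsZero (uExt C D j) := by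
  have (i : ℤ) : Subsingleton (ExtDeg C D j i) := subsingleton_of_forall_eq 0 (h i)
  have : Subsingleton (uExt C D j).carrier :=
    inferInstanceAs (Subsingleton (DirectSum ℤ (ExtDeg C D j)))
  exact isZero_of_subsingleton _

theorem eq_zero_of_isZero_uExt [GradedAlgebra 𝒜] {C : CochainComplex (GrMod.{u, u} 𝒜) ℤ}
    {D : GrMod.{u, u} 𝒜} {j : ℤ} (h : IsZero (uExt C D j)) (i : ℤ) (x : ExtDeg C D j i) :
    x = 0 := by
  have h1 : Subsingleton (DirectSum ℤ (ExtDeg C D j)) := subsingleton_of_isZero h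
  exact DirectSum.of_injective i (Subsingleton.elim _ _)

theorem finite_of_mono {M N : GrMod.{u, u} 𝒜} [IsNoetherianRing A] (f : M ⟶ N) [Mono f]
    (h : Module.Finite A N.carrier) : Module.Finite A M.carrier :=
  Module.Finite.of_injective (lin f) (injective_of_mono f)

theorem finite_of_epi {M N : GrMod.{u, u} 𝒜} (f : M ⟶ N) [Epi f]
    (h : Module.Finite A M.carrier) : Module.Finite A N.carrier :=
  Module.Finite.of_surjective (lin f) (surjective_of_epi f)

/-- Homology is a quotient of the cycles, and these form a submodule of a finitely generated module
over a Noetherian ring. -/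
theorem finite_homology [IsNoetherianRing A] (C : CochainComplex (GrMod.{u, u} 𝒜) ℤ)
    (hC : ∀ i, Module.Finite A (C.X i).carrier) (n : ℤ) :
    Module.Finite A (C.homology n).carrier :=
  finite_of_epi (C.homologyπ n) (finite_of_mono (C.iCycles n) (hC n))

theorem isZero_uExt_self [GradedAlgebra 𝒜] [IsNoetherianRing A]
    (hneg : ∀ e < 0, 𝒜 e = ⊥) (hunit : ∀ r ∈ 𝒜 0, r ≠ 0 → IsUnit r) (d : ℕ)
    (hres : ∀ i : ℤ, i > d → IsZero
      (uExt ((CochainComplex.singleFunctor (GrMod.{u, u} 𝒜) 0).obj (residue 𝒜)) (self 𝒜) i))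
    (C : CochainComplex (GrMod.{u, u} 𝒜) ℤ) (hC : ∀ i, Module.Finite A (C.X i).carrier)
    (s t : ℤ) (hH : ∀ j : ℤ, ¬ (s ≤ j ∧ j ≤ t) → IsZero (C.homology j))
    (j : ℤ) (hj : ¬ (-t ≤ j ∧ j ≤ (d : ℤ) - s)) : IsZero (uExt C (self 𝒜) j) := by
  -- The internal degree `l` part of the graded Ext module is the ordinary Ext group into the twist
  -- by `l`.
  have hres' : ∀ n > d, ∀ l, Subsingleton (Abelian.Ext (residue 𝒜) ((self 𝒜).twist l) n) := by
    intro n hn l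
    refine Abelian.Ext.homEquiv.subsingleton_congr.2 (subsingleton_of_forall_eq 0 fun x => ?_)
    exact eq_zero_of_isZero_uExt (hres n (by exact_mod_cast hn)) l x
  have hGE : (DerivedCategory.Q.obj C).IsGE s := (DerivedCategory.isGE_iff _ _).2 fun i hi =>
    (hH i (by lia)).of_iso ((DerivedCategory.homologyFunctorFactors _ i).app C)
  have hLE : (DerivedCategory.Q.obj C).IsLE t := (DerivedCategory.isLE_iff _ _).2 fun i hi =>
    (hH i (by lia)).of_iso ((DerivedCategory.homologyFunctorFactors _ i).app C)
  refine isZero_uExt fun i x => ?_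
  by_cases hjt : -t ≤ j
  · refine DerivedCategory.eq_zero_of_forall_singleFunctor
      (fun M : GrMod.{u, u} 𝒜 => Module.Finite A M.carrier) (fun _ _ f _ => finite_of_mono f)
      (fun _ _ f _ => finite_of_epi f) _ s (fun M hM n hn f => ?_) t _ (fun n => ?_) x
    -- Here `j > d - s` and `n ≥ s`, so `j + n > d ≥ 0`: the truncation `toNat` loses nothing and
    -- the exponent is in the vanishing range.
    · exact DerivedCategory.singleFunctor_hom_eq_zero (m := (j + n).toNat) (by lia)
        (subsingleton_ext_self_of_residue hneg hunit d hres' M _ (by lia) i) f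
    · exact finite_of_mono ((DerivedCategory.homologyFunctorFactors _ n).app C).hom
        (finite_homology C hC n)
  -- Now `t < -j`, and the t-structure admits no nonzero morphism from degrees `≤ t` to degrees `≥
  -- -j`.
  · have : (((DerivedCategory.singleFunctor (GrMod.{u, u} 𝒜) 0).obj
        ((self 𝒜).twist i))⟦j⟧).IsGE (-j) :=
      DerivedCategory.TStructure.t.isGE_shift _ 0 j (-j) (by lia)
    exact DerivedCategory.TStructure.t.zero_of_isLE_of_isGE x t (-j) (by lia) hLE this

end GrMod

/-! ### Quotients of polynomial rings with the standard grading -/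

/-- The weight of a monomial in the standard grading is its degree. -/
theorem weight_one_eq (n : ℕ) (m : Fin (n + 1) →₀ ℕ) :
    Finsupp.weight (fun _ => (1 : ℤ)) m = m.degree := by
  simp [Finsupp.weight_apply, Finsupp.degree_apply, Finsupp.sum]

theorem polyGrading_eq_bot (k : Type u) [Field k] (n : ℕ) {e : ℤ} (he : e < 0) :
    polyGrading k n e = ⊥ := by
  refine (Submodule.eq_bot_iff _).2 fun p hp => ?_
  ext m
  by_contra h
  have := (MvPolynomial.mem_weightedHomogeneousSubmodule k _ e p).1 hp h
  rw [weight_one_eq] at this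
  lia

theorem exists_C_of_mem_polyGrading_zero (k : Type u) [Field k] (n : ℕ)
    {p : MvPolynomial (Fin (n + 1)) k} (hp : p ∈ polyGrading k n 0) :
    ∃ c : k, p = MvPolynomial.C c := by
  refine ⟨p.coeff 0, ?_⟩
  ext m
  rw [MvPolynomial.coeff_C]
  split_ifs with h
  · rw [h]
  · by_contra h'
    have := (MvPolynomial.mem_weightedHomogeneousSubmodule k _ 0 p).1 hp h'
    rw [weight_one_eq] at this
    exact h ((Finsupp.degree_eq_zero_iff m).1 (by exact_mod_cast this)).symm

theorem proposition3p1 {k : Type u} [Field k] (n : ℕ) (I : HomogeneousIdeal (polyGrading k n))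
    (hG : IsGradedGorenstein (quotGrading I))
    (d : ℕ) (hd : ringKrullDim (MvPolynomial (Fin (n + 1)) k ⧸ I.toIdeal) = d)
    (C : CochainComplex (GrMod.{u, u} (quotGrading I)) ℤ)
    (hC : ∀ i : ℤ, Module.Finite (MvPolynomial (Fin (n + 1)) k ⧸ I.toIdeal) (C.X i).carrier)
    (s t : ℤ) (hH : ∀ j : ℤ, ¬ (s ≤ j ∧ j ≤ t) → IsZero (C.homology j))
    (j : ℤ) (hj : ¬ (-t ≤ j ∧ j ≤ (d : ℤ) - s)) :
    IsZero (GrMod.uExt C (GrMod.self (quotGrading I)) j) := by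
  obtain ⟨d', hd', -, hres⟩ := hG
  obtain rfl : d' = d := by rw [hd] at hd'; exact_mod_cast hd'.symm
  refine GrMod.isZero_uExt_self (fun e he => ?_) (fun r hr hr0 => ?_) d'
    (fun i hi => hres i hi.ne') C hC s t hH j hj
  · rw [quotGrading, polyGrading_eq_bot k n he, Submodule.map_bot]
  -- Degree-zero elements of the quotient are classes of constants, and a nonzero class comes from a
  -- nonzero, hence invertible, constant.
  · obtain ⟨p, hp, rfl⟩ := hr
    obtain ⟨c, rfl⟩ := exists_C_of_mem_polyGrading_zero k n hp
    have hc : c ≠ 0 := by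
      rintro rfl
      exact hr0 (by simp)
    exact ((isUnit_iff_ne_zero.2 hc).map MvPolynomial.C).map (Ideal.Quotient.mk I.toIdeal)
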